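/- Let $E$ be a commutative unital C*-algebra. An $E$-C*-algebra is a C*-algebra $F$ with a bilinear map $E\times F\to F$, $(\alpha,x)\mapsto\alpha x$, such that $(\alpha\beta)x=\alpha(\beta x)$, $1x=x$, $\alpha(xy)=(\alpha x)y=x(\alpha y)$, $(\alpha x)^*=\alpha^*x^*$ and $\|\alpha x\|\le\|\alpha\|\,\|x\|$; morphisms are the $E$-linear $*$-homomorphisms. Let $K_0,K_1$ (indices $i\in\mathbb Z/2$) be covariant functors from $E$-C*-algebras to abelian groups, together with homomorphisms (index maps) $\delta_i:K_i(H)\to K_{i+1}(F)$ for each exact sequence $0\to F\to G\to H\to0$ of $E$-C*-algebras, satisfying the axioms: $K_i(0)=0$; $K_i$ maps split exact sequences to split exact sequences; homotopic morphisms (joined by a pointwise norm-continuous path of morphisms) induce equal maps; for every exact sequence the cyclic six-term sequence formed by the $K_i$ and the $\delta_i$ is exact; the index maps commute with morphisms of exact sequences. For an $E$-C*-algebra $F$ and a C*-algebra $G$ let $F\otimes G$ be the spatial tensor product, with $\alpha(x\otimes y)=(\alpha x)\otimes y$. For $p,q\in\{0,1,2,\dots\}$, we say that $G\in\Upsilon$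 with $p(G)=p$, $q(G)=q$ if there is a family $\Phi$ of group isomorphisms $\Phi_{i,F}:K_i(F)^{p}\times K_{i+1}(F)^{q}\to K_i(F\otimes G)$ that is natural in $F$; such a $\Phi$ is called a $\Upsilon$-structure on $G$ of type $(p,q)$. $G$ is $\Upsilon$-null if it has a $\Upsilon$-structure of type $(0,0)$. $G\in\Upsilon_1$ if $G$ is unital and the maps $K_i(F\to F\otimes G,\ x\mapsto x\otimes 1)$ form a $\Upsilon$-structure of type $(1,0)$. Given a $\Upsilon$-structure $\Phi$ on $G$, let $G_\Upsilon(\Phi)$ be the class of exact sequences $0\to F_1\to F_2\to F_3\to0$ of $E$-C*-algebras, with index maps $\delta_i$, such that $0\to F_1\otimes G\to F_2\otimes G\to F_3\otimes G\to0$ is exact and its index maps $\delta_{G,i}$ satisfy $\delta_{G,i}\circ\Phi_{i,F_3}=\Phi_{i+1,F_1}\circ(\delta_i^{p}\times\delta_{i+1}^{q})$. For a locally compact Hausdorff space $\Omega$ these notions (with $\Omega_\Upsilon(\Phi)$ for $G_\Upsilon(\Phi)$) refer to $G=C_0(\Omega,\mathbb C)$. **Theorem (Alexandroff K-theorem).**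 Let $\Omega$ be a locally compact Hausdorff space and $\Omega^*=\Omega\cup\{\infty\}$ its one-point compactification ($\infty$ being an isolated point if $\Omega$ is compact). (a) For every $E$-C*-algebra $F$ and $i\in\mathbb Z/2$, let $\varphi:C_0(\Omega,F)\to C(\Omega^*,F)$ be extension by $0$ at $\infty$ and $\lambda:F\to C(\Omega^*,F)$ the inclusion as constant functions. Then $(a,b)\mapsto K_i(\varphi)a+K_i(\lambda)b$ is a group isomorphism $K_i(C_0(\Omega,F))\times K_i(F)\to K_i(C(\Omega^*,F))$. (b) If $\Omega\in\Upsilon$ with $p(\Omega)=p$, $q(\Omega)=q$, then $\Omega^*\in\Upsilon$ with $p(\Omega^*)=p+1$, $q(\Omega^*)=q$, and $\Omega_\Upsilon\subset\Omega^*_\Upsilon$. Precisely: for every $\Upsilon$-structure $\Phi$ on $\Omega$ of type $(p,q)$ there is a $\Upsilon$-structure $\Phi^*$ on $\Omega^*$ of type $(p+1,q)$ with $\Omega_\Upsilon(\Phi)\subset\Omega^*_\Upsilon(\Phi^*)$. (c) $\Omega$ is $\Upsilon$-null if and only if $\Omega^*\in\Upsilon_1$. -/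

import Mathlib

open scoped TensorProduct ZeroAtInfty

universe u v w

noncomputable section


/-! ## Completion of a (semi-normed) pre-C*-algebra -/

/-- A pre-C*-algebra: a complex star-algebra with a submultiplicative seminorm satisfying the
C*-identity. -/
class PreCStarAlgebra (R : Type u) extends NonUnitalSeminormedRing R, StarRing R,
    NormedSpace ℂ R, IsScalarTower ℂ R R, SMulCommClass ℂ R R, StarModule ℂ R where
  norm_star' : ∀ x : R, ‖star x‖ = ‖x‖
  norm_star_mul_self' : ∀ x : R, ‖star x * x‖ = ‖x‖ * ‖x‖

/-- The (Hausdorff) completion of a pre-C*-algebra. -/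
def CStarCompletion (R : Type u) [PreCStarAlgebra R] : Type u := UniformSpace.Completion R

namespace CStarCompletion

open UniformSpace UniformSpace.Completion

variable {R : Type u} [PreCStarAlgebra R]

instance : NormedAddCommGroup (CStarCompletion R) :=
  inferInstanceAs (NormedAddCommGroup (Completion R))

instance : NormedSpace ℂ (CStarCompletion R) :=
  inferInstanceAs (NormedSpace ℂ (Completion R))

instance : CompleteSpace (CStarCompletion R) :=
  inferInstanceAs (CompleteSpace (Completion R))

/-- The canonical map of a pre-C*-algebra into its completion. -/
def of (x : R) : CStarCompletion R := ((x : Completion R) : Completion R)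

theorem continuous_of : Continuous (of : R → CStarCompletion R) := continuous_coe R

theorem norm_of (x : R) : ‖of x‖ = ‖x‖ := norm_coe x

theorem of_add (x y : R) : of (x + y) = of x + of y := coe_add x y

theorem of_zero : of (0 : R) = 0 := coe_zero

theorem of_smul (c : ℂ) (x : R) : of (c • x) = c • of x := coe_smul c x

theorem ind {p : CStarCompletion R → Prop} (a : CStarCompletion R)
    (hp : IsClosed {a | p a}) (ih : ∀ x : R, p (of x)) : p a :=
  Completion.induction_on (α := R) a hp ih

theorem ind₂ {p : CStarCompletion R → CStarCompletion R → Prop} (a b : CStarCompletion R)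
    (hp : IsClosed {x : CStarCompletion R × CStarCompletion R | p x.1 x.2})
    (ih : ∀ x y : R, p (of x) (of y)) : p a b :=
  Completion.induction_on₂ (α := R) (β := R) a b hp ih

theorem ind₃ {p : CStarCompletion R → CStarCompletion R → CStarCompletion R → Prop}
    (a b c : CStarCompletion R)
    (hp : IsClosed {x : CStarCompletion R × CStarCompletion R × CStarCompletion R |
      p x.1 x.2.1 x.2.2})
    (ih : ∀ x y z : R, p (of x) (of y) (of z)) : p a b c :=
  Completion.induction_on₃ (α := R) (β := R) (γ := R) a b c hp ih

theorem isDenseInducing_of : IsDenseInducing (of : R → CStarCompletion R) :=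
  isDenseInducing_coe (α := R)

/-- The multiplication extended by continuity. -/
instance : Mul (CStarCompletion R) :=
  ⟨Function.curry <| (isDenseInducing_of.prodMap isDenseInducing_of).extend
    (of ∘ Function.uncurry (· * ·))⟩

theorem of_mul (x y : R) : of (x * y) = of x * of y :=
  ((isDenseInducing_of.prodMap isDenseInducing_of).extend_eq
      (continuous_of.comp (@continuous_mul R _ _ _)) (x, y)).symm

instance : ContinuousMul (CStarCompletion R) where
  continuous_mul := by
    let m := (AddMonoidHom.mul : R →+ R →+ R).compr₂ (toCompl : R →+ Completion R)
    have : Continuous fun p : R × R => m p.1 p.2 := (continuous_coe R).comp continuous_mul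
    have di : IsDenseInducing (toCompl : R → Completion R) := isDenseInducing_coe
    exact (di.extend_Z_bilin di this :)

/-- The involution extended by continuity. -/
instance : Star (CStarCompletion R) := ⟨Completion.map (star : R → R)⟩

theorem uniformContinuous_star : UniformContinuous (star : R → R) := by
  have h : Isometry (starAddEquiv : R ≃+ R) :=
    AddMonoidHomClass.isometry_of_norm _ PreCStarAlgebra.norm_star'
  exact h.uniformContinuous

theorem of_star (x : R) : of (star x) = star (of x) :=
  (Completion.map_coe uniformContinuous_star x).symm

instance : ContinuousStar (CStarCompletion R) :=
  ⟨Completion.continuous_map (f := (star : R → R))⟩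

protected theorem mul_assoc (a b c : CStarCompletion R) : a * b * c = a * (b * c) := by
  induction a, b, c using ind₃ with
  | hp => exact isClosed_eq (by fun_prop) (by fun_prop)
  | ih a b c => simp only [← of_mul, mul_assoc]

protected theorem mul_add (a b c : CStarCompletion R) : a * (b + c) = a * b + a * c := by
  induction a, b, c using ind₃ with
  | hp => exact isClosed_eq (by fun_prop) (by fun_prop)
  | ih a b c => simp only [← of_mul, ← of_add, mul_add]

protected theorem add_mul (a b c : CStarCompletion R) : (a + b) * c = a * c + b * c := by
  induction a, b, c using ind₃ with
  | hp => exact isClosed_eq (by fun_prop) (by fun_prop)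
  | ih a b c => simp only [← of_mul, ← of_add, add_mul]

protected theorem zero_mul (a : CStarCompletion R) : 0 * a = 0 := by
  induction a using ind with
  | hp => exact isClosed_eq (by fun_prop) (by fun_prop)
  | ih a => rw [← of_zero, ← of_mul, zero_mul]

protected theorem mul_zero (a : CStarCompletion R) : a * 0 = 0 := by
  induction a using ind with
  | hp => exact isClosed_eq (by fun_prop) (by fun_prop)
  | ih a => rw [← of_zero, ← of_mul, mul_zero]

protected theorem norm_mul_le (a b : CStarCompletion R) : ‖a * b‖ ≤ ‖a‖ * ‖b‖ := by
  induction a, b using ind₂ with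
  | hp => exact isClosed_le (by fun_prop) (by fun_prop)
  | ih a b => simpa only [← of_mul, norm_of] using norm_mul_le a b

instance : NonUnitalNormedRing (CStarCompletion R) where
  __ : NormedAddCommGroup (CStarCompletion R) := inferInstance
  __ : Mul (CStarCompletion R) := inferInstance
  zero_mul := CStarCompletion.zero_mul
  mul_zero := CStarCompletion.mul_zero
  mul_assoc := CStarCompletion.mul_assoc
  left_distrib := CStarCompletion.mul_add
  right_distrib := CStarCompletion.add_mul
  norm_mul_le := CStarCompletion.norm_mul_le

instance : StarRing (CStarCompletion R) where
  star_involutive a := by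
    induction a using ind with
    | hp => exact isClosed_eq (by fun_prop) (by fun_prop)
    | ih a => rw [← of_star, ← of_star, star_star]
  star_mul a b := by
    induction a, b using ind₂ with
    | hp => exact isClosed_eq (by fun_prop) (by fun_prop)
    | ih a b => simp only [← of_mul, ← of_star, star_mul]
  star_add a b := by
    induction a, b using ind₂ with
    | hp => exact isClosed_eq (by fun_prop) (by fun_prop)
    | ih a b => simp only [← of_add, ← of_star, star_add]

protected theorem smul_mul (c : ℂ) (a b : CStarCompletion R) : (c • a) * b = c • (a * b) := by
  induction a, b using ind₂ with
  | hp =>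
    refine isClosed_eq ?_ ?_
    · exact (continuous_fst.const_smul c).mul continuous_snd
    · exact (continuous_fst.mul continuous_snd).const_smul c
  | ih a b => rw [← of_smul, ← of_mul, ← of_mul, ← of_smul, smul_mul_assoc]

protected theorem mul_smul (c : ℂ) (a b : CStarCompletion R) : a * (c • b) = c • (a * b) := by
  induction a, b using ind₂ with
  | hp =>
    refine isClosed_eq ?_ ?_
    · exact continuous_fst.mul (continuous_snd.const_smul c)
    · exact (continuous_fst.mul continuous_snd).const_smul c
  | ih a b => rw [← of_smul, ← of_mul, ← of_mul, ← of_smul, mul_smul_comm]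

protected theorem star_smul (c : ℂ) (a : CStarCompletion R) : star (c • a) = star c • star a := by
  induction a using ind with
  | hp =>
    refine isClosed_eq ?_ ?_
    · exact (continuous_id.const_smul c).star
    · exact continuous_star.const_smul (star c)
  | ih a => rw [← of_smul, ← of_star, ← of_star, ← of_smul, star_smul]

instance : NonUnitalCStarAlgebra (CStarCompletion R) where
  norm_smul_le := norm_smul_le
  norm_mul_self_le a := by
    induction a using ind with
    | hp => exact isClosed_le (by fun_prop) (by fun_prop)
    | ih a => rw [← of_star, ← of_mul, norm_of, norm_of, PreCStarAlgebra.norm_star_mul_self']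
  smul_assoc := CStarCompletion.smul_mul
  smul_comm c a b := (CStarCompletion.mul_smul c a b).symm
  star_smul := CStarCompletion.star_smul

end CStarCompletion


/-! ## The spatial tensor product of C*-algebras -/

/-- A representation of a C*-algebra `A` on a Hilbert space. -/
structure HilbertRep (A : Type u) [NonUnitalCStarAlgebra A] where
  /-- the Hilbert space -/
  space : Type u
  [normedAddCommGroup : NormedAddCommGroup space]
  [innerProductSpace : InnerProductSpace ℂ space]
  [completeSpace : CompleteSpace space]
  /-- the representation -/
  rep : A →⋆ₙₐ[ℂ] (space →L[ℂ] space)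

attribute [instance] HilbertRep.normedAddCommGroup HilbertRep.innerProductSpace
  HilbertRep.completeSpace

namespace HilbertRep

variable {A B : Type u} [NonUnitalCStarAlgebra A] [NonUnitalCStarAlgebra B]

/-- The Hilbert space tensor product of the spaces of two representations. -/
def tensorSpace (π : HilbertRep A) (ρ : HilbertRep B) : Type u :=
  UniformSpace.Completion (π.space ⊗[ℂ] ρ.space)

instance (π : HilbertRep A) (ρ : HilbertRep B) : NormedAddCommGroup (tensorSpace π ρ) :=
  inferInstanceAs (NormedAddCommGroup (UniformSpace.Completion (π.space ⊗[ℂ] ρ.space)))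

instance (π : HilbertRep A) (ρ : HilbertRep B) : InnerProductSpace ℂ (tensorSpace π ρ) :=
  inferInstanceAs (InnerProductSpace ℂ (UniformSpace.Completion (π.space ⊗[ℂ] ρ.space)))

instance (π : HilbertRep A) (ρ : HilbertRep B) : CompleteSpace (tensorSpace π ρ) :=
  inferInstanceAs (CompleteSpace (UniformSpace.Completion (π.space ⊗[ℂ] ρ.space)))

/-- The inclusion of the algebraic tensor product into the Hilbert space tensor product. -/
def toSpace (π : HilbertRep A) (ρ : HilbertRep B) :
    π.space ⊗[ℂ] ρ.space →ₗᵢ[ℂ] tensorSpace π ρ :=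
  UniformSpace.Completion.toComplₗᵢ

/-- The operator `S ⊗ T` on the Hilbert space tensor product. -/
def opTensor (π : HilbertRep A) (ρ : HilbertRep B) (S : π.space →L[ℂ] π.space)
    (T : ρ.space →L[ℂ] ρ.space) : tensorSpace π ρ →L[ℂ] tensorSpace π ρ :=
  (TensorProduct.mapL S T).completion

variable (π : HilbertRep A) (ρ : HilbertRep B)

theorem opTensor_toSpace (S : π.space →L[ℂ] π.space) (T : ρ.space →L[ℂ] ρ.space)
    (x : π.space ⊗[ℂ] ρ.space) :
    opTensor π ρ S T (toSpace π ρ x) = toSpace π ρ (TensorProduct.mapL S T x) :=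
  ContinuousLinearMap.completion_apply_coe (TensorProduct.mapL S T) x

theorem space_ind {p : tensorSpace π ρ → Prop} (a : tensorSpace π ρ)
    (hp : IsClosed {a | p a}) (ih : ∀ x : π.space ⊗[ℂ] ρ.space, p (toSpace π ρ x)) : p a :=
  UniformSpace.Completion.induction_on (α := π.space ⊗[ℂ] ρ.space) a hp ih

theorem ext_toSpace {S T : tensorSpace π ρ →L[ℂ] tensorSpace π ρ}
    (h : ∀ x : π.space ⊗[ℂ] ρ.space, S (toSpace π ρ x) = T (toSpace π ρ x)) : S = T := by
  ext x
  induction x using space_ind with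
  | hp => exact isClosed_eq S.continuous T.continuous
  | ih x => exact h x

theorem opTensor_add_left (S S' : π.space →L[ℂ] π.space) (T : ρ.space →L[ℂ] ρ.space) :
    opTensor π ρ (S + S') T = opTensor π ρ S T + opTensor π ρ S' T := by
  apply ext_toSpace
  intro x
  simp only [add_apply, opTensor_toSpace, TensorProduct.mapL_add_left, map_add]

theorem opTensor_add_right (S : π.space →L[ℂ] π.space) (T T' : ρ.space →L[ℂ] ρ.space) :
    opTensor π ρ S (T + T') = opTensor π ρ S T + opTensor π ρ S T' := by
  apply ext_toSpace
  intro x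
  simp only [add_apply, opTensor_toSpace, TensorProduct.mapL_add_right, map_add]

theorem opTensor_smul_left (c : ℂ) (S : π.space →L[ℂ] π.space) (T : ρ.space →L[ℂ] ρ.space) :
    opTensor π ρ (c • S) T = c • opTensor π ρ S T := by
  apply ext_toSpace
  intro x
  simp only [smul_apply, opTensor_toSpace, TensorProduct.mapL_smul_left, map_smul]

theorem opTensor_smul_right (c : ℂ) (S : π.space →L[ℂ] π.space) (T : ρ.space →L[ℂ] ρ.space) :
    opTensor π ρ S (c • T) = c • opTensor π ρ S T := by
  apply ext_toSpace
  intro x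
  simp only [smul_apply, opTensor_toSpace, TensorProduct.mapL_smul_right, map_smul]

theorem opTensor_mul (S S' : π.space →L[ℂ] π.space) (T T' : ρ.space →L[ℂ] ρ.space) :
    opTensor π ρ (S * S') (T * T') = opTensor π ρ S T * opTensor π ρ S' T' := by
  apply ext_toSpace
  intro x
  simp only [mul_apply_eq_comp, opTensor_toSpace, TensorProduct.mapL_mul]

theorem inner_mapL (S : π.space →L[ℂ] π.space) (T : ρ.space →L[ℂ] ρ.space)
    (x y : π.space ⊗[ℂ] ρ.space) :
    inner ℂ (TensorProduct.mapL (star S) (star T) x) y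
      = inner ℂ x (TensorProduct.mapL S T y) := by
  induction x using TensorProduct.induction_on with
  | zero => simp
  | add x x' hx hx' => simp only [map_add, inner_add_left, hx, hx']
  | tmul a b =>
    induction y using TensorProduct.induction_on with
    | zero => simp
    | add y y' hy hy' => simp only [map_add, inner_add_right, hy, hy']
    | tmul c d =>
      simp [ContinuousLinearMap.star_eq_adjoint, ContinuousLinearMap.adjoint_inner_left]

theorem opTensor_star (S : π.space →L[ℂ] π.space) (T : ρ.space →L[ℂ] ρ.space) :
    opTensor π ρ (star S) (star T) = star (opTensor π ρ S T) := by
  rw [ContinuousLinearMap.star_eq_adjoint (opTensor π ρ S T), ContinuousLinearMap.eq_adjoint_iff]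
  intro x y
  induction x using space_ind with
  | hp => apply isClosed_eq <;> fun_prop
  | ih x =>
    induction y using space_ind with
    | hp => apply isClosed_eq <;> fun_prop
    | ih y =>
      rw [opTensor_toSpace, opTensor_toSpace, LinearIsometry.inner_map_map,
        LinearIsometry.inner_map_map, inner_mapL]

/-- The tensor product `π ⊗ ρ` of two representations, as a map on the algebraic tensor product:
`x ⊗ y` acts as `π x ⊗ ρ y`. -/
def tensor : A ⊗[ℂ] B →ₗ[ℂ] (tensorSpace π ρ →L[ℂ] tensorSpace π ρ) :=
  TensorProduct.lift <| LinearMap.mk₂ ℂ (fun x y => opTensor π ρ (π.rep x) (ρ.rep y))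
    (fun x x' y => by rw [map_add, opTensor_add_left])
    (fun c x y => by rw [map_smul, opTensor_smul_left])
    (fun x y y' => by rw [map_add, opTensor_add_right])
    (fun c x y => by rw [map_smul, opTensor_smul_right])

theorem tensor_tmul (x : A) (y : B) :
    tensor π ρ (x ⊗ₜ y) = opTensor π ρ (π.rep x) (ρ.rep y) := by
  simp [tensor]

theorem tensor_mul (z z' : A ⊗[ℂ] B) : tensor π ρ (z * z') = tensor π ρ z * tensor π ρ z' := by
  induction z using TensorProduct.induction_on with
  | zero => simp
  | add x x' hx hx' => simp only [add_mul, map_add, hx, hx']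
  | tmul a b =>
    induction z' using TensorProduct.induction_on with
    | zero => simp
    | add y y' hy hy' => simp only [mul_add, map_add, hy, hy']
    | tmul c d =>
      rw [Algebra.TensorProduct.tmul_mul_tmul, tensor_tmul, tensor_tmul, tensor_tmul, map_mul,
        map_mul, opTensor_mul]

theorem tensor_star (z : A ⊗[ℂ] B) : tensor π ρ (star z) = star (tensor π ρ z) := by
  induction z using TensorProduct.induction_on with
  | zero => simp
  | add x x' hx hx' => simp only [star_add, map_add, hx, hx']
  | tmul a b =>
    rw [TensorProduct.star_tmul, tensor_tmul, tensor_tmul, map_star, map_star, opTensor_star]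

theorem norm_opTensor_le (S : π.space →L[ℂ] π.space) (T : ρ.space →L[ℂ] ρ.space) :
    ‖opTensor π ρ S T‖ ≤ ‖S‖ * ‖T‖ := by
  refine ContinuousLinearMap.opNorm_le_bound _ (by positivity) fun x => ?_
  induction x using space_ind with
  | hp => apply isClosed_le <;> fun_prop
  | ih x =>
    rw [opTensor_toSpace, LinearIsometry.norm_map, LinearIsometry.norm_map]
    exact (ContinuousLinearMap.le_opNorm _ _).trans
      (mul_le_mul_of_nonneg_right (TensorProduct.norm_mapL_le S T) (norm_nonneg _))

theorem exists_bound (z : A ⊗[ℂ] B) :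
    ∃ C : ℝ, ∀ (π : HilbertRep A) (ρ : HilbertRep B), ‖tensor π ρ z‖ ≤ C := by
  induction z using TensorProduct.induction_on with
  | zero => exact ⟨0, fun π ρ => by simp⟩
  | add x y hx hy =>
    obtain ⟨C, hC⟩ := hx
    obtain ⟨D, hD⟩ := hy
    refine ⟨C + D, fun π ρ => ?_⟩
    rw [map_add]
    exact (norm_add_le _ _).trans (add_le_add (hC π ρ) (hD π ρ))
  | tmul a b =>
    refine ⟨‖a‖ * ‖b‖, fun π ρ => ?_⟩
    rw [tensor_tmul]
    refine (norm_opTensor_le π ρ _ _).trans ?_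
    gcongr
    · exact NonUnitalStarAlgHom.norm_apply_le π.rep a
    · exact NonUnitalStarAlgHom.norm_apply_le ρ.rep b

end HilbertRep

/-- The algebraic tensor product `A ⊙ B` of two C*-algebras; it carries the spatial norm. -/
def AlgTensor (A B : Type u) [NonUnitalCStarAlgebra A] [NonUnitalCStarAlgebra B] : Type u :=
  A ⊗[ℂ] B

namespace AlgTensor

variable {A B : Type u} [NonUnitalCStarAlgebra A] [NonUnitalCStarAlgebra B]

instance : NonUnitalRing (AlgTensor A B) := inferInstanceAs (NonUnitalRing (A ⊗[ℂ] B))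
instance : Module ℂ (AlgTensor A B) := inferInstanceAs (Module ℂ (A ⊗[ℂ] B))
instance : StarAddMonoid (AlgTensor A B) := inferInstanceAs (StarAddMonoid (A ⊗[ℂ] B))

/-- The identity map from `A ⊗[ℂ] B`. -/
def mk : A ⊗[ℂ] B ≃ₗ[ℂ] AlgTensor A B := LinearEquiv.refl ℂ (A ⊗[ℂ] B)

theorem mk_tmul_mul (a c : A) (b d : B) :
    mk (a ⊗ₜ[ℂ] b) * mk (c ⊗ₜ[ℂ] d) = mk ((a * c) ⊗ₜ[ℂ] (b * d)) :=
  Algebra.TensorProduct.tmul_mul_tmul a c b d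

theorem star_mk_tmul (a : A) (b : B) : star (mk (a ⊗ₜ[ℂ] b)) = mk (star a ⊗ₜ[ℂ] star b) :=
  TensorProduct.star_tmul a b

@[elab_as_elim]
theorem ind {p : AlgTensor A B → Prop} (z : AlgTensor A B) (zero : p 0)
    (tmul : ∀ a b, p (mk (a ⊗ₜ[ℂ] b))) (add : ∀ x y, p x → p y → p (x + y)) : p z :=
  TensorProduct.induction_on (motive := p) z zero tmul add

instance : StarRing (AlgTensor A B) where
  star_mul x y := by
    induction x using ind with
    | zero => rw [zero_mul, star_zero, mul_zero]
    | add x x' hx hx' => simp only [add_mul, mul_add, star_add, hx, hx']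
    | tmul a b =>
      induction y using ind with
      | zero => rw [mul_zero, star_zero, zero_mul]
      | add y y' hy hy' => simp only [add_mul, mul_add, star_add, hy, hy']
      | tmul c d => simp only [mk_tmul_mul, star_mk_tmul, star_mul]
  star_add := star_add

/-- The representation `π ⊗ ρ` of `A ⊙ B`. -/
def rep (π : HilbertRep A) (ρ : HilbertRep B) :
    AlgTensor A B →ₗ[ℂ] (HilbertRep.tensorSpace π ρ →L[ℂ] HilbertRep.tensorSpace π ρ) :=
  HilbertRep.tensor π ρ

theorem rep_tmul (π : HilbertRep A) (ρ : HilbertRep B) (a : A) (b : B) :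
    rep π ρ (mk (a ⊗ₜ[ℂ] b)) = HilbertRep.opTensor π ρ (π.rep a) (ρ.rep b) :=
  HilbertRep.tensor_tmul π ρ a b

theorem rep_mul (π : HilbertRep A) (ρ : HilbertRep B) (x y : AlgTensor A B) :
    rep π ρ (x * y) = rep π ρ x * rep π ρ y :=
  HilbertRep.tensor_mul π ρ x y

theorem rep_star (π : HilbertRep A) (ρ : HilbertRep B) (x : AlgTensor A B) :
    rep π ρ (star x) = star (rep π ρ x) :=
  HilbertRep.tensor_star π ρ x

/-- The spatial norm: the supremum of `‖(π ⊗ ρ) z‖` over all representations `π` of `A` and `ρ`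
of `B`. -/
instance : Norm (AlgTensor A B) :=
  ⟨fun z => ⨆ p : HilbertRep A × HilbertRep B, ‖rep p.1 p.2 z‖⟩

theorem norm_def (z : AlgTensor A B) :
    ‖z‖ = ⨆ p : HilbertRep A × HilbertRep B, ‖rep p.1 p.2 z‖ := rfl

theorem bddAbove (z : AlgTensor A B) : BddAbove (Set.range
    fun p : HilbertRep A × HilbertRep B => ‖rep p.1 p.2 z‖) := by
  obtain ⟨C, hC⟩ := HilbertRep.exists_bound z
  exact ⟨C, by rintro _ ⟨p, rfl⟩; exact hC p.1 p.2⟩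

theorem le_norm (π : HilbertRep A) (ρ : HilbertRep B) (z : AlgTensor A B) :
    ‖rep π ρ z‖ ≤ ‖z‖ :=
  le_ciSup (bddAbove z) (π, ρ)

theorem norm_le {z : AlgTensor A B} {C : ℝ} (hC : 0 ≤ C)
    (h : ∀ (π : HilbertRep A) (ρ : HilbertRep B), ‖rep π ρ z‖ ≤ C) : ‖z‖ ≤ C :=
  Real.iSup_le (fun p => h p.1 p.2) hC

protected theorem norm_nonneg (z : AlgTensor A B) : 0 ≤ ‖z‖ :=
  Real.iSup_nonneg fun _ => norm_nonneg _

protected theorem norm_mul_le (x y : AlgTensor A B) : ‖x * y‖ ≤ ‖x‖ * ‖y‖ := by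
  refine norm_le (mul_nonneg (AlgTensor.norm_nonneg x) (AlgTensor.norm_nonneg y)) fun π ρ => ?_
  rw [rep_mul]
  exact (norm_mul_le _ _).trans
    (mul_le_mul (le_norm π ρ x) (le_norm π ρ y) (norm_nonneg _) (AlgTensor.norm_nonneg x))

protected theorem norm_star (x : AlgTensor A B) : ‖star x‖ = ‖x‖ := by
  simp only [norm_def, rep_star, norm_star]

protected theorem norm_star_mul_self (x : AlgTensor A B) : ‖star x * x‖ = ‖x‖ * ‖x‖ := by
  refine le_antisymm ?_ ?_
  · exact (AlgTensor.norm_mul_le _ _).trans (by rw [AlgTensor.norm_star])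
  · have key : ‖x‖ ≤ Real.sqrt ‖star x * x‖ := by
      refine norm_le (Real.sqrt_nonneg _) fun π ρ => Real.le_sqrt_of_sq_le ?_
      rw [sq, ← CStarRing.norm_star_mul_self, ← rep_star, ← rep_mul]
      exact le_norm π ρ _
    calc ‖x‖ * ‖x‖ ≤ Real.sqrt ‖star x * x‖ * Real.sqrt ‖star x * x‖ :=
          mul_self_le_mul_self (AlgTensor.norm_nonneg x) key
      _ = ‖star x * x‖ := Real.mul_self_sqrt (AlgTensor.norm_nonneg _)

/-- The spatial norm as a seminorm. -/
def seminorm : AddGroupSeminorm (AlgTensor A B) where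
  toFun z := ‖z‖
  map_zero' := by simp only [norm_def, map_zero, norm_zero, Real.iSup_const_zero]
  add_le' x y := norm_le (add_nonneg (AlgTensor.norm_nonneg x) (AlgTensor.norm_nonneg y))
    fun π ρ => by
      rw [map_add]
      exact (norm_add_le _ _).trans (add_le_add (le_norm π ρ x) (le_norm π ρ y))
  neg' x := by simp only [norm_def, map_neg, norm_neg]

instance : SeminormedAddCommGroup (AlgTensor A B) := seminorm.toSeminormedAddCommGroup

instance : PreCStarAlgebra (AlgTensor A B) where
  __ : SeminormedAddCommGroup (AlgTensor A B) := inferInstance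
  __ : NonUnitalRing (AlgTensor A B) := inferInstance
  __ : StarRing (AlgTensor A B) := inferInstance
  __ : Module ℂ (AlgTensor A B) := inferInstance
  norm_mul_le := AlgTensor.norm_mul_le
  norm_smul_le c x := norm_le (mul_nonneg (norm_nonneg c) (AlgTensor.norm_nonneg x))
    fun π ρ => by
      rw [map_smul, norm_smul]
      exact mul_le_mul_of_nonneg_left (le_norm π ρ x) (norm_nonneg c)
  smul_assoc := fun c x y => smul_mul_assoc (β := A ⊗[ℂ] B) c x y
  smul_comm := fun c x y => (mul_smul_comm (β := A ⊗[ℂ] B) c x y).symm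
  star_smul := fun c x => star_smul (A := A ⊗[ℂ] B) c x
  norm_star' := AlgTensor.norm_star
  norm_star_mul_self' := AlgTensor.norm_star_mul_self

end AlgTensor


namespace CStarCompletion

open UniformSpace UniformSpace.Completion

section Action

variable {E : Type v} [CommCStarAlgebra E] {R : Type u} [PreCStarAlgebra R] [Module E R]
  [IsBoundedSMul E R]

instance (priority := 50) : Module E (CStarCompletion R) := inferInstanceAs (Module E (Completion R))

theorem of_smul' (α : E) (x : R) : of (α • x) = α • of x := coe_smul α x

theorem norm_smul_le' (α : E) (a : CStarCompletion R) : ‖α • a‖ ≤ ‖α‖ * ‖a‖ := by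
  induction a using ind with
  | hp =>
    refine isClosed_le ?_ ?_
    · exact continuous_norm.comp (uniformContinuous_const_smul (X := Completion R) α).continuous
    · fun_prop
  | ih a => rw [← of_smul', norm_of, norm_of]; exact norm_smul_le α a

instance (priority := 50) : IsBoundedSMul E (CStarCompletion R) := IsBoundedSMul.of_norm_smul_le norm_smul_le'

instance [IsScalarTower ℂ E R] : IsScalarTower ℂ E (CStarCompletion R) where
  smul_assoc c α a := by
    induction a using ind with
    | hp =>
      refine isClosed_eq ?_ ?_
      · exact continuous_const_smul (c • α)
      · exact (continuous_const_smul α).const_smul c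
    | ih a => rw [← of_smul', ← of_smul', ← of_smul, smul_assoc]

instance [IsScalarTower E R R] : IsScalarTower E (CStarCompletion R) (CStarCompletion R) where
  smul_assoc α a b := by
    simp only [smul_eq_mul]
    induction a, b using ind₂ with
    | hp =>
      refine isClosed_eq ?_ ?_
      · exact (continuous_fst.const_smul α).mul continuous_snd
      · exact (continuous_fst.mul continuous_snd).const_smul α
    | ih a b => rw [← of_smul', ← of_mul, ← of_mul, ← of_smul', smul_mul_assoc]

instance [SMulCommClass E R R] : SMulCommClass E (CStarCompletion R) (CStarCompletion R) where
  smul_comm α a b := by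
    simp only [smul_eq_mul]
    induction a, b using ind₂ with
    | hp =>
      refine isClosed_eq ?_ ?_
      · exact (continuous_fst.mul continuous_snd).const_smul α
      · exact continuous_fst.mul (continuous_snd.const_smul α)
    | ih a b => rw [← of_smul', ← of_mul, ← of_mul, ← of_smul', mul_smul_comm]

instance [StarModule E R] : StarModule E (CStarCompletion R) where
  star_smul α a := by
    induction a using ind with
    | hp =>
      refine isClosed_eq ?_ ?_
      · exact (continuous_id.const_smul α).star
      · exact continuous_star.const_smul (star α)
    | ih a => rw [← of_smul', ← of_star, ← of_star, ← of_smul', star_smul]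

end Action

section Map

variable {E : Type v} [CommCStarAlgebra E]
  {R S : Type u} [PreCStarAlgebra R] [PreCStarAlgebra S] [Module E R] [Module E S]

/-- The extension of a map to the completions. -/
def mapFun (f : R → S) : CStarCompletion R → CStarCompletion S := Completion.map f

theorem continuous_mapFun (f : R → S) : Continuous (mapFun f) := Completion.continuous_map

theorem mapFun_of (f : R →⋆ₙₐ[E] S) (hf : ∀ x, ‖f x‖ ≤ ‖x‖) (x : R) :
    mapFun f (of x) = of (f x) :=
  Completion.map_coe
    (AddMonoidHomClass.lipschitz_of_bound f 1 (by simpa using hf)).uniformContinuous x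

variable [IsBoundedSMul E R] [IsBoundedSMul E S]

/-- The canonical star-homomorphism into the completion. -/
def ofHom : R →⋆ₙₐ[E] CStarCompletion R where
  toFun := of
  map_smul' α x := of_smul' α x
  map_zero' := of_zero
  map_add' := of_add
  map_mul' := of_mul
  map_star' := of_star

/-- The extension of a contractive star-homomorphism to the completions. -/
def map (f : R →⋆ₙₐ[E] S) (hf : ∀ x, ‖f x‖ ≤ ‖x‖) :
    CStarCompletion R →⋆ₙₐ[E] CStarCompletion S where
  toFun := mapFun f
  map_smul' α a := by
    induction a using ind with
    | hp =>
      refine isClosed_eq ?_ ?_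
      · exact (continuous_mapFun f).comp (continuous_const_smul α)
      · exact (continuous_mapFun f).const_smul α
    | ih a => rw [← of_smul', mapFun_of f hf, mapFun_of f hf, map_smul, of_smul']; rfl
  map_zero' := by rw [← of_zero, mapFun_of f hf, map_zero, of_zero]
  map_add' a b := by
    induction a, b using ind₂ with
    | hp =>
      refine isClosed_eq ?_ ?_
      · exact (continuous_mapFun f).comp continuous_add
      · exact ((continuous_mapFun f).comp continuous_fst).add
          ((continuous_mapFun f).comp continuous_snd)
    | ih a b =>
      rw [← of_add, mapFun_of f hf, mapFun_of f hf, mapFun_of f hf, map_add, of_add]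
  map_mul' a b := by
    induction a, b using ind₂ with
    | hp =>
      refine isClosed_eq ?_ ?_
      · exact (continuous_mapFun f).comp continuous_mul
      · exact ((continuous_mapFun f).comp continuous_fst).mul
          ((continuous_mapFun f).comp continuous_snd)
    | ih a b =>
      rw [← of_mul, mapFun_of f hf, mapFun_of f hf, mapFun_of f hf, map_mul, of_mul]
  map_star' a := by
    induction a using ind with
    | hp =>
      refine isClosed_eq ?_ ?_
      · exact (continuous_mapFun f).comp continuous_star
      · exact (continuous_mapFun f).star
    | ih a => rw [← of_star, mapFun_of f hf, mapFun_of f hf, map_star, of_star]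

theorem map_of (f : R →⋆ₙₐ[E] S) (hf : ∀ x, ‖f x‖ ≤ ‖x‖) (x : R) :
    map f hf (of x) = of (f x) := mapFun_of f hf x

end Map

end CStarCompletion

/-! ## `E`-C*-algebras -/

/-- An `E`-C*-algebra: a C*-algebra `F` with a bilinear exterior multiplication `E × F → F` such
that `(α β) x = α (β x)`, `1 x = x`, `α (x y) = (α x) y = x (α y)`, `(α x)* = α* x*` and
`‖α x‖ ≤ ‖α‖ ‖x‖`. -/
structure ECStarAlg (E : Type v) [CommCStarAlgebra E] : Type (max v (u + 1)) where
  /-- the underlying C*-algebra -/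
  carrier : Type u
  [cstar : NonUnitalCStarAlgebra carrier]
  [module : Module E carrier]
  [tower : IsScalarTower ℂ E carrier]
  [smulMul : IsScalarTower E carrier carrier]
  [mulSMul : SMulCommClass E carrier carrier]
  [starModule : StarModule E carrier]
  [bounded : IsBoundedSMul E carrier]

namespace ECStarAlg

attribute [instance] cstar module tower smulMul mulSMul starModule bounded

variable {E : Type v} [CommCStarAlgebra E]

instance : CoeSort (ECStarAlg.{u} E) (Type u) := ⟨ECStarAlg.carrier⟩

/-- Morphisms are the `E`-linear C*-homomorphisms. -/
instance : CategoryTheory.Category (ECStarAlg.{u} E) where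
  Hom F G := F →⋆ₙₐ[E] G
  id F := NonUnitalStarAlgHom.id E F
  comp φ ψ := ψ.comp φ

/-- The underlying star-homomorphism of a morphism. -/
def hom {F G : ECStarAlg.{u} E} (φ : F ⟶ G) : F →⋆ₙₐ[E] G := φ

/-- The morphism defined by an `E`-linear star-homomorphism. -/
def ofHom {F G : ECStarAlg.{u} E} (φ : F →⋆ₙₐ[E] G) : F ⟶ G := φ

instance (F : ECStarAlg.{u} E) : SMulCommClass ℂ E F where
  smul_comm c α x := by
    rw [← smul_one_smul E c (α • x), ← smul_one_smul E c x, smul_smul, smul_smul, mul_comm]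

instance (F : ECStarAlg.{u} E) : SMulCommClass E ℂ F := SMulCommClass.symm _ _ _

/-- An `E`-linear C*-homomorphism is complex linear. -/
def toComplexHom {F G : ECStarAlg.{u} E} (φ : F →⋆ₙₐ[E] G) : F →⋆ₙₐ[ℂ] G where
  toFun := φ
  map_smul' c x := by
    rw [← smul_one_smul E c x, map_smul, smul_one_smul]; rfl
  map_zero' := map_zero φ
  map_add' := map_add φ
  map_mul' := map_mul φ
  map_star' := map_star φ

end ECStarAlg

/-! ## The tensor product of an `E`-C*-algebra and a C*-algebra -/

theorem exists_complement {E : Type v} [CommCStarAlgebra E] (α : E) :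
    ∃ β : E, star α * α + star β * β = ((‖α‖ ^ 2 : ℝ) : ℂ) • (1 : E) := by
  let _ := CStarAlgebra.spectralOrder E
  have := CStarAlgebra.spectralOrderedRing E
  have h : star α * α ≤ algebraMap ℝ E (‖α‖ ^ 2) := CStarAlgebra.star_mul_le_algebraMap_norm_sq
  obtain ⟨β, hβ⟩ := CStarAlgebra.nonneg_iff_eq_star_mul_self.mp (sub_nonneg.mpr h)
  refine ⟨β, ?_⟩
  rw [← hβ, add_sub_cancel, Algebra.algebraMap_eq_smul_one]
  exact (Complex.coe_smul _ _).symm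

/-- `e` is a unit element of the C*-algebra `G`. -/
def IsUnitElement {G : Type u} [NonUnitalCStarAlgebra G] (e : G) : Prop :=
  ∀ x : G, e * x = x ∧ x * e = x

theorem IsUnitElement.star_eq {G : Type u} [NonUnitalCStarAlgebra G] {e : G}
    (he : IsUnitElement e) : star e = e := by
  have h := (he (star e)).1
  have h' := congrArg star h
  rw [star_mul, star_star, h] at h'
  exact h'

namespace AlgTensor

section Action

variable {E : Type v} [CommCStarAlgebra E] (F : ECStarAlg.{u} E) (G : Type u)
  [NonUnitalCStarAlgebra G]

/-- The exterior multiplication `α (x ⊗ y) = (α x) ⊗ y`. -/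
instance : Module E (AlgTensor F G) := inferInstanceAs (Module E (F.carrier ⊗[ℂ] G))

variable {F G}

theorem smul_mk (α : E) (x : F) (y : G) : α • mk (x ⊗ₜ[ℂ] y) = mk ((α • x) ⊗ₜ[ℂ] y) :=
  TensorProduct.smul_tmul' α x y

instance : IsScalarTower ℂ E (AlgTensor F G) where
  smul_assoc c α z := by
    induction z using ind with
    | zero => simp only [smul_zero]
    | add x y hx hy => simp only [smul_add, hx, hy]
    | tmul a b =>
      rw [smul_mk, smul_mk, ← map_smul, TensorProduct.smul_tmul', smul_assoc]

instance : IsScalarTower E (AlgTensor F G) (AlgTensor F G) where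
  smul_assoc α z z' := by
    simp only [smul_eq_mul]
    induction z using ind with
    | zero => simp only [smul_zero, zero_mul]
    | add x y hx hy => simp only [smul_add, add_mul, hx, hy]
    | tmul a b =>
      induction z' using ind with
      | zero => simp only [smul_zero, mul_zero]
      | add x y hx hy => simp only [smul_add, mul_add, hx, hy]
      | tmul c d => rw [smul_mk, mk_tmul_mul, mk_tmul_mul, smul_mk, smul_mul_assoc]

instance : SMulCommClass E (AlgTensor F G) (AlgTensor F G) where
  smul_comm α z z' := by
    simp only [smul_eq_mul]
    induction z using ind with
    | zero => simp only [smul_zero, zero_mul]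
    | add x y hx hy => simp only [smul_add, add_mul, hx, hy]
    | tmul a b =>
      induction z' using ind with
      | zero => simp only [smul_zero, mul_zero]
      | add x y hx hy => simp only [smul_add, mul_add, hx, hy]
      | tmul c d => rw [smul_mk, mk_tmul_mul, mk_tmul_mul, smul_mk, mul_smul_comm]

instance : StarModule E (AlgTensor F G) where
  star_smul α z := by
    induction z using ind with
    | zero => simp only [smul_zero, star_zero]
    | add x y hx hy => simp only [smul_add, star_add, hx, hy]
    | tmul a b => rw [smul_mk, star_mk_tmul, star_mk_tmul, smul_mk, star_smul]

theorem norm_smul_le' (α : E) (z : AlgTensor F G) : ‖α • z‖ ≤ ‖α‖ * ‖z‖ := by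
  refine norm_le (by positivity) fun π ρ => ?_
  refine (ContinuousLinearMap.opNorm_le_bound _ (by positivity) fun ξ => ?_ :
    ‖rep π ρ (α • z)‖ ≤ ‖α‖ * ‖rep π ρ z‖).trans
      (mul_le_mul_of_nonneg_left (le_norm π ρ z) (norm_nonneg α))
  obtain ⟨β, hβ⟩ := exists_complement α
  have h1 : ∀ γ : E, star (γ • z) * (γ • z) = (star γ * γ) • (star z * z) := fun γ => by
    rw [star_smul, smul_mul_assoc, mul_smul_comm, smul_smul]
  have h2 : star (α • z) * (α • z) + star (β • z) * (β • z)
      = ((‖α‖ ^ 2 : ℝ) : ℂ) • (star z * z) := by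
    rw [h1, h1, ← add_smul, hβ, smul_assoc, one_smul]
  have h3 : ∀ y : AlgTensor F G, inner ℂ (rep π ρ (star y * y) ξ) ξ
      = ((‖rep π ρ y ξ‖ ^ 2 : ℝ) : ℂ) := fun y => by
    rw [rep_mul, rep_star, mul_apply_eq_comp, ContinuousLinearMap.star_eq_adjoint,
      ContinuousLinearMap.adjoint_inner_left, inner_self_eq_norm_sq_to_K]
    norm_cast
  have h4 := congrArg (fun y => inner ℂ (rep π ρ y ξ) ξ) h2
  simp only [map_add, map_smul, add_apply, smul_apply, inner_add_left, inner_smul_left, h3,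
    Complex.conj_ofReal] at h4
  have h5 : ‖rep π ρ (α • z) ξ‖ ^ 2 + ‖rep π ρ (β • z) ξ‖ ^ 2 = ‖α‖ ^ 2 * ‖rep π ρ z ξ‖ ^ 2 := by
    exact_mod_cast h4
  have h6 : ‖rep π ρ (α • z) ξ‖ ≤ ‖α‖ * ‖rep π ρ z ξ‖ := by
    refine abs_le_of_sq_le_sq' ?_ (by positivity) |>.2
    rw [mul_pow]
    nlinarith [sq_nonneg ‖rep π ρ (β • z) ξ‖]
  calc ‖rep π ρ (α • z) ξ‖ ≤ ‖α‖ * ‖rep π ρ z ξ‖ := h6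
    _ ≤ ‖α‖ * (‖rep π ρ z‖ * ‖ξ‖) :=
      mul_le_mul_of_nonneg_left (ContinuousLinearMap.le_opNorm _ _) (norm_nonneg α)
    _ = ‖α‖ * ‖rep π ρ z‖ * ‖ξ‖ := (mul_assoc _ _ _).symm

instance : IsBoundedSMul E (AlgTensor F G) := IsBoundedSMul.of_norm_smul_le norm_smul_le'

end Action

section Map

variable {E : Type v} [CommCStarAlgebra E] {F F' : ECStarAlg.{u} E} {G G' : Type u}
  [NonUnitalCStarAlgebra G] [NonUnitalCStarAlgebra G']

/-- The linear map `x ⊗ y ↦ φ x ⊗ ψ y`. -/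
def mapLinear (φ : F →⋆ₙₐ[E] F') (ψ : G →⋆ₙₐ[ℂ] G') : AlgTensor F G →ₗ[ℂ] AlgTensor F' G' :=
  (mk.toLinearMap ∘ₗ TensorProduct.map (LinearMapClass.linearMap (ECStarAlg.toComplexHom φ))
    (LinearMapClass.linearMap ψ)) ∘ₗ mk.symm.toLinearMap

theorem mapLinear_mk (φ : F →⋆ₙₐ[E] F') (ψ : G →⋆ₙₐ[ℂ] G') (x : F) (y : G) :
    mapLinear φ ψ (mk (x ⊗ₜ[ℂ] y)) = mk (φ x ⊗ₜ[ℂ] ψ y) := rfl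

/-- The star-homomorphism `x ⊗ y ↦ φ x ⊗ ψ y`. -/
def map (φ : F →⋆ₙₐ[E] F') (ψ : G →⋆ₙₐ[ℂ] G') : AlgTensor F G →⋆ₙₐ[E] AlgTensor F' G' where
  toFun := mapLinear φ ψ
  map_smul' α z := by
    induction z using ind with
    | zero => simp only [smul_zero, map_zero]
    | add x y hx hy => simp only [smul_add, map_add, hx, hy]
    | tmul a b => rw [smul_mk, mapLinear_mk, mapLinear_mk, map_smul]; exact (smul_mk α _ _).symm
  map_zero' := map_zero _
  map_add' := map_add _
  map_mul' z z' := by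
    induction z using ind with
    | zero => simp only [zero_mul, map_zero]
    | add x y hx hy => simp only [add_mul, map_add, hx, hy]
    | tmul a b =>
      induction z' using ind with
      | zero => simp only [mul_zero, map_zero]
      | add x y hx hy => simp only [mul_add, map_add, hx, hy]
      | tmul c d =>
        rw [mk_tmul_mul, mapLinear_mk, mapLinear_mk, mapLinear_mk, mk_tmul_mul, map_mul, map_mul]
  map_star' z := by
    induction z using ind with
    | zero => simp only [star_zero, map_zero]
    | add x y hx hy => simp only [star_add, map_add, hx, hy]
    | tmul a b =>
      rw [star_mk_tmul, mapLinear_mk, mapLinear_mk, star_mk_tmul, map_star, map_star]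

theorem map_mk (φ : F →⋆ₙₐ[E] F') (ψ : G →⋆ₙₐ[ℂ] G') (x : F) (y : G) :
    map φ ψ (mk (x ⊗ₜ[ℂ] y)) = mk (φ x ⊗ₜ[ℂ] ψ y) := rfl

theorem norm_map_le (φ : F →⋆ₙₐ[E] F') (ψ : G →⋆ₙₐ[ℂ] G') (z : AlgTensor F G) :
    ‖map φ ψ z‖ ≤ ‖z‖ := by
  refine norm_le (norm_nonneg z) fun π ρ => ?_
  let π' : HilbertRep F := ⟨π.space, π.rep.comp (ECStarAlg.toComplexHom φ)⟩
  let ρ' : HilbertRep G := ⟨ρ.space, ρ.rep.comp ψ⟩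
  have h : rep π ρ (map φ ψ z) = rep π' ρ' z := by
    induction z using ind with
    | zero => rw [map_zero, map_zero, map_zero]; rfl
    | add x y hx hy => rw [map_add, map_add, map_add, hx, hy]; rfl
    | tmul a b => rw [map_mk, rep_tmul, rep_tmul]; rfl
  rw [h]
  exact le_norm π' ρ' z

/-- The star-homomorphism `x ↦ x ⊗ e` into the algebraic tensor product, `e` the unit of `G`. -/
def unitHom (F : ECStarAlg.{u} E) (e : G) (he : IsUnitElement e) : F →⋆ₙₐ[E] AlgTensor F G where
  toFun x := mk (x ⊗ₜ[ℂ] e)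
  map_smul' α x := (smul_mk α x e).symm
  map_zero' := by rw [TensorProduct.zero_tmul, map_zero]
  map_add' x y := by rw [TensorProduct.add_tmul, map_add]
  map_mul' x y := by rw [mk_tmul_mul, (he e).1]
  map_star' x := by rw [star_mk_tmul, he.star_eq]

end Map

end AlgTensor

namespace ECStarAlg

variable {E : Type v} [CommCStarAlgebra E]

/-- The spatial tensor product `F ⊗ G` of an `E`-C*-algebra `F` and a C*-algebra `G`. -/
def tensor (F : ECStarAlg.{u} E) (G : Type u) [NonUnitalCStarAlgebra G] : ECStarAlg.{u} E where
  carrier := CStarCompletion (AlgTensor F G)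

section

variable {F F' : ECStarAlg.{u} E} {G G' : Type u} [NonUnitalCStarAlgebra G]
  [NonUnitalCStarAlgebra G']

/-- The elementary tensor `x ⊗ y`. -/
def tmul (x : F) (y : G) : F.tensor G := CStarCompletion.of (AlgTensor.mk (x ⊗ₜ[ℂ] y))

/-- The morphism `φ ⊗ ψ : F ⊗ G ⟶ F' ⊗ G'`. -/
def tensorMap (φ : F ⟶ F') (ψ : G →⋆ₙₐ[ℂ] G') : F.tensor G ⟶ F'.tensor G' :=
  ofHom (CStarCompletion.map (AlgTensor.map (hom φ) ψ) (AlgTensor.norm_map_le (hom φ) ψ))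

theorem tensorMap_tmul (φ : F ⟶ F') (ψ : G →⋆ₙₐ[ℂ] G') (x : F) (y : G) :
    hom (tensorMap φ ψ) (tmul x y) = tmul (hom φ x) (ψ y) :=
  CStarCompletion.map_of _ (AlgTensor.norm_map_le (hom φ) ψ) _

end

/-- The morphism `F ⟶ F ⊗ G`, `x ↦ x ⊗ 1`, for a C*-algebra `G` with unit `e`. -/
def tensorUnit (F : ECStarAlg.{u} E) {G : Type u} [NonUnitalCStarAlgebra G] (e : G)
    (he : IsUnitElement e) : F ⟶ F.tensor G :=
  ofHom (CStarCompletion.ofHom.comp (AlgTensor.unitHom F e he))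

theorem tensorUnit_apply (F : ECStarAlg.{u} E) {G : Type u} [NonUnitalCStarAlgebra G] (e : G)
    (he : IsUnitElement e) (x : F) : hom (F.tensorUnit e he) x = tmul x e := rfl

end ECStarAlg


/-! ## Algebras of continuous functions -/

namespace ECStarAlg

variable {E : Type v} [CommCStarAlgebra E]

/-- The `E`-C*-algebra `C(X, F)` of continuous functions on a compact space, with pointwise
operations. -/
def continuousFunctions (X : Type u) [TopologicalSpace X] [CompactSpace X]
    (F : ECStarAlg.{u} E) : ECStarAlg.{u} E where
  carrier := C(X, F)
  tower := ⟨fun c α f => ContinuousMap.ext fun x => smul_assoc c α (f x)⟩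
  smulMul := ⟨fun α f g => ContinuousMap.ext fun x => smul_mul_assoc α (f x) (g x)⟩
  mulSMul := ⟨fun α f g => ContinuousMap.ext fun x => (mul_smul_comm α (f x) (g x)).symm⟩
  starModule := ⟨fun α f => ContinuousMap.ext fun x => star_smul α (f x)⟩
  bounded := IsBoundedSMul.of_norm_smul_le fun α f =>
    (ContinuousMap.norm_le _ (by positivity)).mpr fun x => (norm_smul_le α (f x)).trans
      (mul_le_mul_of_nonneg_left (f.norm_coe_le_norm x) (norm_nonneg α))

/-- The `E`-C*-algebra `C₀(Ω, F)` of continuous functions vanishing at infinity, with pointwise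
operations. -/
def zeroAtInfty (Ω : Type u) [TopologicalSpace Ω] (F : ECStarAlg.{u} E) : ECStarAlg.{u} E where
  carrier := C₀(Ω, F)
  tower := ⟨fun c α f => ZeroAtInftyContinuousMap.ext fun x => smul_assoc c α (f x)⟩
  smulMul := ⟨fun α f g => ZeroAtInftyContinuousMap.ext fun x => smul_mul_assoc α (f x) (g x)⟩
  mulSMul := ⟨fun α f g =>
    ZeroAtInftyContinuousMap.ext fun x => (mul_smul_comm α (f x) (g x)).symm⟩
  starModule := ⟨fun α f => ZeroAtInftyContinuousMap.ext fun x => star_smul α (f x)⟩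
  bounded := IsBoundedSMul.of_norm_smul_le fun α f => by
    rw [← ZeroAtInftyContinuousMap.norm_toBCF_eq_norm]
    refine (BoundedContinuousFunction.norm_le (by positivity)).mpr fun x => ?_
    refine (norm_smul_le α (f x)).trans (mul_le_mul_of_nonneg_left ?_ (norm_nonneg α))
    rw [← ZeroAtInftyContinuousMap.norm_toBCF_eq_norm]
    exact f.toBCF.norm_coe_le_norm x

/-- The function on the one-point compactification that extends `f ∈ C₀(Ω, F)` by `0` at `∞`. -/
def extendByZero {Ω : Type u} [TopologicalSpace Ω] [T2Space Ω] {F : Type u}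
    [NonUnitalCStarAlgebra F] (f : C₀(Ω, F)) : C(OnePoint Ω, F) :=
  OnePoint.continuousMapMk f.toContinuousMap 0 (by
    rw [Filter.coclosedCompact_eq_cocompact]; exact f.zero_at_infty')

/-- The inclusion `C₀(Ω, F) ⟶ C(Ω*, F)`. -/
def inclusion (Ω : Type u) [TopologicalSpace Ω] [T2Space Ω] (F : ECStarAlg.{u} E) :
    zeroAtInfty Ω F ⟶ continuousFunctions (OnePoint Ω) F :=
  ofHom (F := zeroAtInfty Ω F) (G := continuousFunctions (OnePoint Ω) F)
    { toFun := fun f => extendByZero (F := F) f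
      map_smul' := fun α f => ContinuousMap.ext fun x => by
        cases x using OnePoint.rec with
        | infty => exact (smul_zero α).symm
        | coe x => rfl
      map_zero' := ContinuousMap.ext fun x => by
        cases x using OnePoint.rec with
        | infty => rfl
        | coe x => rfl
      map_add' := fun f g => ContinuousMap.ext fun x => by
        cases x using OnePoint.rec with
        | infty => exact (add_zero (0 : F)).symm
        | coe x => rfl
      map_mul' := fun f g => ContinuousMap.ext fun x => by
        cases x using OnePoint.rec with
        | infty => exact (mul_zero (0 : F)).symm
        | coe x => rfl
      map_star' := fun f => ContinuousMap.ext fun x => by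
        cases x using OnePoint.rec with
        | infty => exact (star_zero F).symm
        | coe x => rfl }

/-- The morphism `F ⟶ C(X, F)` which sends `y` to the constant function with value `y`. -/
def constants (X : Type u) [TopologicalSpace X] [CompactSpace X] (F : ECStarAlg.{u} E) :
    F ⟶ continuousFunctions X F :=
  ofHom (F := F) (G := continuousFunctions X F)
    { toFun := fun y => ContinuousMap.const X y
      map_smul' := fun _ _ => rfl
      map_zero' := rfl
      map_add' := fun _ _ => rfl
      map_mul' := fun _ _ => rfl
      map_star' := fun _ => rfl }

/-! ## Axiomatic K-theory -/

/-- The sequence `0 ⟶ F ⟶ G ⟶ H ⟶ 0` is exact. -/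
structure ShortExact {F G H : ECStarAlg.{u} E} (φ : F ⟶ G) (ψ : G ⟶ H) : Prop where
  injective : Function.Injective (hom φ)
  exact : Function.Exact (hom φ) (hom ψ)
  surjective : Function.Surjective (hom ψ)

/-- Two morphisms are homotopic if they are joined by a pointwise continuous path of morphisms. -/
def Homotopic {F G : ECStarAlg.{u} E} (φ ψ : F ⟶ G) : Prop :=
  ∃ Φ : unitInterval → (F ⟶ G), Φ 0 = φ ∧ Φ 1 = ψ ∧ ∀ x : F, Continuous fun s => hom (Φ s) x

end ECStarAlg

open CategoryTheory ECStarAlg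

/-- The group homomorphism `T(φ)`, for a functor `T` with values in abelian groups. -/
def ECStarAlg.mapHom {E : Type v} [CommCStarAlgebra E] (T : ECStarAlg.{u} E ⥤ AddCommGrpCat.{w})
    {F G : ECStarAlg.{u} E} (φ : F ⟶ G) : T.obj F →+ T.obj G := (T.map φ).hom

/-- A K-theory on the category of `E`-C*-algebras: two covariant functors `K₀`, `K₁` to abelian
groups (indexed by `ℤ/2`), and for each short exact sequence two index maps, subject to the axioms
below. -/
structure KTheory (E : Type v) [CommCStarAlgebra E] where
  /-- the functors `K₀` and `K₁` -/
  K : ZMod 2 → (ECStarAlg.{u} E ⥤ AddCommGrpCat.{w})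
  /-- the index maps `δᵢ : Kᵢ(H) → Kᵢ₊₁(F)` of a short exact sequence -/
  index : ∀ (i : ZMod 2) {F G H : ECStarAlg.{u} E} (φ : F ⟶ G) (ψ : G ⟶ H),
    ShortExact φ ψ → ((K i).obj H →+ (K (i + 1)).obj F)
  /-- null-axiom: `Kᵢ(0) = 0` -/
  null : ∀ (i : ZMod 2) (F : ECStarAlg.{u} E), Subsingleton F → Subsingleton ((K i).obj F)
  /-- split exact axiom: `Kᵢ` maps split exact sequences to split exact sequences -/
  split_exact : ∀ (i : ZMod 2) {F G H : ECStarAlg.{u} E} (φ : F ⟶ G) (ψ : G ⟶ H) (σ : H ⟶ G),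
    ShortExact φ ψ → σ ≫ ψ = 𝟙 H →
      Function.Injective (mapHom (K i) φ) ∧
      Function.Exact (mapHom (K i) φ) (mapHom (K i) ψ) ∧
      Function.LeftInverse (mapHom (K i) ψ) (mapHom (K i) σ)
  /-- homotopy axiom -/
  homotopy : ∀ (i : ZMod 2) {F G : ECStarAlg.{u} E} (φ ψ : F ⟶ G), Homotopic φ ψ →
    mapHom (K i) φ = mapHom (K i) ψ
  /-- six-term axiom: the cyclic sequence of the `Kᵢ` and the index maps is exact -/
  six_term : ∀ (i : ZMod 2) {F G H : ECStarAlg.{u} E} (φ : F ⟶ G) (ψ : G ⟶ H)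
    (h : ShortExact φ ψ),
      Function.Exact (mapHom (K i) φ) (mapHom (K i) ψ) ∧
      Function.Exact (mapHom (K i) ψ) (index i φ ψ h) ∧
      Function.Exact (index i φ ψ h) (mapHom (K (i + 1)) φ)
  /-- commutativity of the index maps with morphisms of short exact sequences -/
  index_natural : ∀ (i : ZMod 2) {F G H F' G' H' : ECStarAlg.{u} E}
    (φ : F ⟶ G) (ψ : G ⟶ H) (h : ShortExact φ ψ)
    (φ' : F' ⟶ G') (ψ' : G' ⟶ H') (h' : ShortExact φ' ψ')
    (f₁ : F ⟶ F') (f₂ : G ⟶ G') (f₃ : H ⟶ H'), φ ≫ f₂ = f₁ ≫ φ' → ψ ≫ f₃ = f₂ ≫ ψ' →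
      ∀ a : (K i).obj H,
        mapHom (K (i + 1)) f₁ (index i φ ψ h a) = index i φ' ψ' h' (mapHom (K i) f₃ a)

/-! ## The classes `Υ` and `Υ₁` -/

section Upsilon

variable {E : Type v} [CommCStarAlgebra E]

/-- Group isomorphisms `Φᵢ,F : Kᵢ(F)^p × Kᵢ₊₁(F)^q → Kᵢ(F ⊗ G)`, natural in the `E`-C*-algebra `F`.
A C*-algebra `G` belongs to the class `Υ` with numbers `p(G) = p`, `q(G) = q` if such a family
exists. -/
structure UpsilonIso (K : KTheory.{u, v, w} E) (G : Type u) [NonUnitalCStarAlgebra G]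
    (p q : ℕ) where
  /-- the isomorphisms -/
  iso : ∀ (i : ZMod 2) (F : ECStarAlg.{u} E),
    ((Fin p → (K.K i).obj F) × (Fin q → (K.K (i + 1)).obj F)) ≃+ (K.K i).obj (F.tensor G)
  natural : ∀ (i : ZMod 2) {F F' : ECStarAlg.{u} E} (φ : F ⟶ F')
    (x : (Fin p → (K.K i).obj F) × (Fin q → (K.K (i + 1)).obj F)),
      mapHom (K.K i) (tensorMap φ (NonUnitalStarAlgHom.id ℂ G)) (iso i F x)
        = iso i F' (fun j => mapHom (K.K i) φ (x.1 j), fun j => mapHom (K.K (i + 1)) φ (x.2 j))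

/-- The short exact sequence `0 ⟶ F₁ ⟶ F₂ ⟶ F₃ ⟶ 0` belongs to `G_Υ` (with respect to the
isomorphisms `Φ`): tensoring with `G` gives an exact sequence, and the isomorphisms `Φ` intertwine
the index maps of the two sequences. -/
def UpsilonIso.Intertwines {K : KTheory.{u, v, w} E} {G : Type u} [NonUnitalCStarAlgebra G]
    {p q : ℕ} (Φ : UpsilonIso K G p q) {F₁ F₂ F₃ : ECStarAlg.{u} E} (φ₁ : F₁ ⟶ F₂) (φ₂ : F₂ ⟶ F₃)
    (h : ShortExact φ₁ φ₂) : Prop :=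
  ∃ hG : ShortExact (tensorMap φ₁ (NonUnitalStarAlgHom.id ℂ G))
      (tensorMap φ₂ (NonUnitalStarAlgHom.id ℂ G)),
    ∀ (i : ZMod 2) (x : (Fin p → (K.K i).obj F₃) × (Fin q → (K.K (i + 1)).obj F₃)),
      K.index i _ _ hG (Φ.iso i F₃ x)
        = Φ.iso (i + 1) F₁
            (fun j => K.index i φ₁ φ₂ h (x.1 j), fun j => K.index (i + 1) φ₁ φ₂ h (x.2 j))

/-- `G` is `Υ`-null: it belongs to `Υ` with `p(G) = q(G) = 0`. -/
def IsUpsilonNull (K : KTheory.{u, v, w} E) (G : Type u) [NonUnitalCStarAlgebra G] : Prop :=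
  Nonempty (UpsilonIso K G 0 0)

/-- `G` belongs to `Υ₁`: it is unital and belongs to `Υ` with `p(G) = 1`, `q(G) = 0` and
`Φᵢ,F = Kᵢ(x ↦ x ⊗ 1)`. -/
def IsUpsilonOne (K : KTheory.{u, v, w} E) (G : Type u) [NonUnitalCStarAlgebra G] : Prop :=
  ∃ (e : G) (he : IsUnitElement e) (Φ : UpsilonIso K G 1 0),
    ∀ (i : ZMod 2) (F : ECStarAlg.{u} E)
      (x : (Fin 1 → (K.K i).obj F) × (Fin 0 → (K.K (i + 1)).obj F)),
        Φ.iso i F x = mapHom (K.K i) (F.tensorUnit e he) (x.1 0)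

end Upsilon

end

open CategoryTheory ECStarAlg

/-! Write `A` for `C₀(Ω, ℂ)` and `B` for `C(Ω*, ℂ)`. Then `B` is a unitization of `A`: evaluation at
`∞` is a character `χ` of `B` with kernel `A`, and `χ` takes the value 1 at the unit `e`. The
theorem follows once tensoring with any `F` gives an exact sequence `0 ⟶ F ⊗ A ⟶ F ⊗ B ⟶ F ⟶ 0`,
split by `x ↦ x ⊗ e` (`IsUnitization.shortExact_tensor`). Split exactness of K-theory then yields
`Kᵢ(F ⊗ B) ≅ Kᵢ(F ⊗ A) × Kᵢ(F)`, naturally in `F`: the new factor raises `p` by one and leaves `q`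
alone, and it is the whole group exactly when the K-groups of `F ⊗ A` vanish. Index maps respect
this decomposition because they commute with morphisms of exact sequences. For (a) the same argument
applies directly to `C₀(Ω, F)` and `C(Ω*, F)`, with no tensor product involved.

The analytic work lies in two norm estimates. The slice map `x ⊗ y ↦ χ y • x` is contractive for the
spatial norm (`AlgTensor.norm_slice_le`); this uses a representation of `F` attaining the norm of a
given element, obtained by the GNS construction. The map `F ⊗ A ⟶ F ⊗ B` is isometric
(`IsUnitization.norm_le_norm_map`), because every representation of `A` extends to `B` on the same
Hilbert space. -/

/-! ## States and the Gelfand–Naimark theorem -/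

namespace CStarAlgebra

/-- Shifting `b` by `it` changes the imaginary part of `f b` by `t`, while the C*-identity bounds
`‖b + it‖²` by `‖b‖² + t²`. The terms in `t²` cancel, and what remains is an inequality linear in
`t` that must hold for every real `t`. -/
theorem im_eq_zero_of_norm_le_one {A : Type u} [CStarAlgebra A] [Nontrivial A] {f : A →L[ℂ] ℂ}
    (hf : ‖f‖ ≤ 1) (h1 : f 1 = 1) {b : A} (hb : IsSelfAdjoint b) : (f b).im = 0 := by
  have key : ∀ t : ℝ, 2 * t * (f b).im ≤ ‖b‖ ^ 2 := fun t => by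
    obtain ⟨c, hc⟩ : ∃ c : ℂ, c = t * Complex.I := ⟨_, rfl⟩
    have hcc : star c = -c := by
      rw [hc, star_mul', Complex.star_def, Complex.conj_ofReal, Complex.conj_I,
        mul_neg]
    have hc2 : -(c * c) = ((t ^ 2 : ℝ) : ℂ) := by
      rw [hc]
      push_cast
      linear_combination (-(t : ℂ) ^ 2) * Complex.I_sq
    have e1 : f (b + c • 1) = f b + t * Complex.I := by
      rw [map_add, map_smul, h1, smul_eq_mul, mul_one, hc]
    have e2 : star (b + c • (1 : A)) * (b + c • 1) = b * b + ((t ^ 2 : ℝ) : ℂ) • 1 := by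
      rw [star_add, star_smul, star_one, hb.star_eq, hcc, ← hc2]
      simp only [add_mul, mul_add, smul_mul_assoc, mul_smul_comm, one_mul, mul_one, neg_smul,
        smul_add, smul_smul, smul_neg, neg_mul]
      abel
    have e3 : ‖f b + t * Complex.I‖ ^ 2 ≤ ‖b‖ ^ 2 + t ^ 2 := by
      rw [← e1]
      calc ‖f (b + c • 1)‖ ^ 2 ≤ ‖b + c • (1 : A)‖ ^ 2 := by
            gcongr
            exact (f.le_opNorm _).trans (mul_le_of_le_one_left (norm_nonneg _) hf)
        _ = ‖b * b + ((t ^ 2 : ℝ) : ℂ) • (1 : A)‖ := by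
          rw [sq, ← CStarRing.norm_star_mul_self, e2]
        _ ≤ ‖b‖ * ‖b‖ + ‖((t ^ 2 : ℝ) : ℂ) • (1 : A)‖ :=
          (norm_add_le _ _).trans (by gcongr; exact norm_mul_le _ _)
        _ = ‖b‖ ^ 2 + t ^ 2 := by
          rw [norm_smul, Complex.norm_real, Real.norm_of_nonneg (sq_nonneg t), norm_one, mul_one,
            sq ‖b‖]
    rw [← Complex.normSq_eq_norm_sq, Complex.normSq_apply] at e3
    simp only [Complex.add_re, Complex.add_im, Complex.mul_re, Complex.mul_im, Complex.ofReal_re,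
      Complex.ofReal_im, Complex.I_re, Complex.I_im] at e3
    nlinarith [sq_nonneg (f b).re, sq_nonneg (f b).im]
  by_contra h
  -- This `t` turns the left side of `key` into `2 (‖b‖² + 1)`, which exceeds `‖b‖²`.
  have := key ((‖b‖ ^ 2 + 1) / (f b).im)
  rw [mul_assoc, div_mul_cancel₀ _ h] at this
  nlinarith [sq_nonneg ‖b‖]

section States

open scoped ComplexOrder

variable {A : Type u} [CStarAlgebra A] [PartialOrder A] [StarOrderedRing A]

/-- For positive elements, norm bounds are order bounds by scalars, so `1 + a ≤ ‖1 + a‖` can be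
shifted to `a ≤ ‖1 + a‖ - 1`. -/
theorem norm_one_add_of_nonneg [Nontrivial A] {a : A} (ha : 0 ≤ a) : ‖1 + a‖ = 1 + ‖a‖ := by
  refine le_antisymm ((norm_add_le _ _).trans (by rw [norm_one])) ?_
  have h1 : (1 : ℝ) ≤ ‖1 + a‖ := by
    have h := norm_le_norm_of_nonneg_of_le (zero_le_one (α := A)) (le_add_of_nonneg_right ha)
    rwa [norm_one] at h
  have h2 : 1 + a ≤ algebraMap ℝ A ‖1 + a‖ :=
    (norm_le_iff_le_algebraMap _ (norm_nonneg _) (add_nonneg zero_le_one ha)).mp le_rfl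
  have h3 : a ≤ algebraMap ℝ A (‖1 + a‖ - 1) := by
    rw [map_sub, map_one]
    exact le_sub_iff_add_le'.mpr h2
  linarith [(norm_le_iff_le_algebraMap a (sub_nonneg.mpr h1) ha).mpr h3]

/-- Positivity places `‖b‖ - b` in the ball of radius `‖b‖`, so `f b` lies within `‖b‖` of the
number `‖b‖`. A real number with this property is nonnegative. -/
theorem nonneg_of_norm_le_one [Nontrivial A] {f : A →L[ℂ] ℂ} (hf : ‖f‖ ≤ 1) (h1 : f 1 = 1)
    {b : A} (hb : 0 ≤ b) : 0 ≤ f b := by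
  have him := im_eq_zero_of_norm_le_one hf h1 hb.isSelfAdjoint
  refine Complex.nonneg_iff.mpr ⟨?_, him.symm⟩
  have h2 : ‖algebraMap ℝ A ‖b‖ - b‖ ≤ ‖b‖ := by
    refine (norm_le_iff_le_algebraMap _ (norm_nonneg b) ?_).mpr (sub_le_self _ hb)
    exact sub_nonneg.mpr hb.isSelfAdjoint.le_algebraMap_norm_self
  have h3 : ‖f (algebraMap ℝ A ‖b‖ - b)‖ ≤ ‖b‖ :=
    (f.le_opNorm _).trans ((mul_le_of_le_one_left (norm_nonneg _) hf).trans h2)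
  have h4 : f (algebraMap ℝ A ‖b‖ - b) = (‖b‖ : ℂ) - f b := by
    rw [map_sub, Algebra.algebraMap_eq_smul_one, ← Complex.coe_smul, map_smul, h1, smul_eq_mul,
      mul_one]
  have h5 := (Complex.re_le_norm _).trans (h4 ▸ h3)
  rw [Complex.sub_re, Complex.ofReal_re] at h5
  linarith

/-- A positive element attains its norm at a state. -/
theorem exists_state_apply_eq_norm [Nontrivial A] {a : A} (ha : 0 ≤ a) :
    ∃ f : A →ₚ[ℂ] ℂ, f 1 = 1 ∧ f a = (‖a‖ : ℂ) := by
  -- Hahn–Banach is applied to `1 + a` rather than to `a`: since `g 1 + g a = 1 + ‖a‖` with `|g 1| ≤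
  -- 1` and `|g a| ≤ ‖a‖`, both bounds must be attained, so `g` is normalised at 1 as well.
  obtain ⟨g, hg, hga⟩ := exists_dual_vector'' ℂ (1 + a)
  rw [norm_one_add_of_nonneg ha, map_add] at hga
  have b1 : ‖g 1‖ ≤ 1 := (g.le_opNorm 1).trans (by rwa [norm_one, mul_one])
  have b2 : ‖g a‖ ≤ ‖a‖ := (g.le_opNorm a).trans (mul_le_of_le_one_left (norm_nonneg _) hg)
  have hre : (g 1).re + (g a).re = 1 + ‖a‖ := by simpa using congrArg Complex.re hga
  have r1 : (g 1).re = ‖g 1‖ := by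
    linarith [Complex.re_le_norm (g 1), Complex.re_le_norm (g a)]
  have r1' : ‖g 1‖ = 1 := by linarith [Complex.re_le_norm (g 1), Complex.re_le_norm (g a)]
  have h1 : g 1 = 1 := by
    have h := (Complex.nonneg_iff.mp (Complex.re_eq_norm.mp r1)).2
    exact Complex.ext (r1.trans r1') h.symm
  refine ⟨PositiveLinearMap.mk₀ g.toLinearMap fun b hb => nonneg_of_norm_le_one hg h1 hb, h1, ?_⟩
  rw [h1] at hga
  have : g a = (‖a‖ : ℂ) := by
    push_cast at hga
    exact add_left_cancel hga
  exact this

/-- The GNS representation of a state which attains the norm of `star x * x` is isometric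
at `x`. -/
theorem exists_state_norm_le_norm_gns [Nontrivial A] (x : A) :
    ∃ f : A →ₚ[ℂ] ℂ, ‖x‖ ≤ ‖f.gnsNonUnitalStarAlgHom x‖ := by
  obtain ⟨f, h1, hx⟩ := exists_state_apply_eq_norm (star_mul_self_nonneg x)
  refine ⟨f, ?_⟩
  -- The class of 1 is a unit vector of the GNS space, and `x` sends it to the class of `x`, whose
  -- norm is `√f(x* x) = ‖x‖`.
  have n1 : ‖f.toPreGNS 1‖ = 1 := by
    rw [f.preGNS_norm_def, f.ofPreGNS_toPreGNS, star_one, one_mul, h1, Complex.one_re,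
      Real.sqrt_one]
  have nx : ‖f.toPreGNS x‖ = ‖x‖ := by
    rw [f.preGNS_norm_def, f.ofPreGNS_toPreGNS, hx, Complex.ofReal_re,
      CStarRing.norm_star_mul_self, Real.sqrt_mul_self (norm_nonneg x)]
  have h := (f.gnsNonUnitalStarAlgHom x).le_opNorm (f.toPreGNS 1 : f.GNS)
  rw [f.gnsNonUnitalStarAlgHom_apply_coe, UniformSpace.Completion.norm_coe,
    UniformSpace.Completion.norm_coe, n1, mul_one, f.leftMulMapPreGNS_apply] at h
  simpa [nx] using h

end States

end CStarAlgebra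

/-- Representations of a C*-algebra attain its norm. -/
theorem HilbertRep.exists_norm_le {A : Type u} [NonUnitalCStarAlgebra A] (x : A) :
    ∃ π : HilbertRep A, ‖x‖ ≤ ‖π.rep x‖ := by
  -- The unitization supplies the unit on which states are normalised, and `A` embeds in it
  -- isometrically.
  let _ := CStarAlgebra.spectralOrder (Unitization ℂ A)
  have := CStarAlgebra.spectralOrderedRing (Unitization ℂ A)
  obtain ⟨f, hf⟩ := CStarAlgebra.exists_state_norm_le_norm_gns (x : Unitization ℂ A)
  rw [Unitization.norm_inr] at hf
  exact ⟨⟨f.GNS, f.gnsNonUnitalStarAlgHom.comp (Unitization.inrNonUnitalStarAlgHom ℂ A)⟩, hf⟩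

/-! ## Extension of morphisms to the completion -/

namespace CStarCompletion

variable {E : Type v} [CommCStarAlgebra E] {R S : Type u} [PreCStarAlgebra R] [Module E R]
  [NonUnitalCStarAlgebra S] [Module E S]

/-- The extension of a contraction into a C*-algebra to the completion. -/
noncomputable def liftFun (f : R → S) : CStarCompletion R → S :=
  UniformSpace.Completion.extension f

theorem continuous_liftFun (f : R → S) : Continuous (liftFun f) :=
  UniformSpace.Completion.continuous_extension

theorem liftFun_of (f : R →⋆ₙₐ[E] S) (hf : ∀ x, ‖f x‖ ≤ ‖x‖) (x : R) : liftFun f (of x) = f x :=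
  UniformSpace.Completion.extension_coe
    (AddMonoidHomClass.lipschitz_of_bound f 1 (by simpa using hf)).uniformContinuous x

variable [IsBoundedSMul E R] [IsBoundedSMul E S]

/-- The extension of a contractive star-homomorphism into a C*-algebra to the completion. -/
noncomputable def lift (f : R →⋆ₙₐ[E] S) (hf : ∀ x, ‖f x‖ ≤ ‖x‖) : CStarCompletion R →⋆ₙₐ[E] S where
  toFun := liftFun f
  map_smul' α a := by
    induction a using ind with
    | hp =>
      refine isClosed_eq ?_ ?_
      · exact (continuous_liftFun f).comp (continuous_const_smul α)
      · exact (continuous_liftFun f).const_smul α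
    | ih a => rw [← of_smul', liftFun_of f hf, liftFun_of f hf, map_smul]; rfl
  map_zero' := by rw [← of_zero, liftFun_of f hf, map_zero]
  map_add' a b := by
    induction a, b using ind₂ with
    | hp =>
      refine isClosed_eq ?_ ?_
      · exact (continuous_liftFun f).comp continuous_add
      · exact ((continuous_liftFun f).comp continuous_fst).add
          ((continuous_liftFun f).comp continuous_snd)
    | ih a b => rw [← of_add, liftFun_of f hf, liftFun_of f hf, liftFun_of f hf, map_add]
  map_mul' a b := by
    induction a, b using ind₂ with
    | hp =>
      refine isClosed_eq ?_ ?_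
      · exact (continuous_liftFun f).comp continuous_mul
      · exact ((continuous_liftFun f).comp continuous_fst).mul
          ((continuous_liftFun f).comp continuous_snd)
    | ih a b => rw [← of_mul, liftFun_of f hf, liftFun_of f hf, liftFun_of f hf, map_mul]
  map_star' a := by
    induction a using ind with
    | hp =>
      refine isClosed_eq ?_ ?_
      · exact (continuous_liftFun f).comp continuous_star
      · exact (continuous_liftFun f).star
    | ih a => rw [← of_star, liftFun_of f hf, liftFun_of f hf, map_star]

theorem lift_of (f : R →⋆ₙₐ[E] S) (hf : ∀ x, ‖f x‖ ≤ ‖x‖) (x : R) : lift f hf (of x) = f x :=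
  liftFun_of f hf x

end CStarCompletion

/-! ## Slice maps of characters -/

namespace AlgTensor

section Slice

variable {E : Type v} [CommCStarAlgebra E] {F : ECStarAlg.{u} E} {G : Type u}
  [NonUnitalCStarAlgebra G]

/-- The linear map `x ⊗ y ↦ χ y • x`. -/
noncomputable def sliceLinear (χ : G →⋆ₙₐ[ℂ] ℂ) : AlgTensor F G →ₗ[ℂ] F :=
  TensorProduct.lift ((LinearMap.lsmul ℂ F.carrier).flip.compl₂ (LinearMapClass.linearMap χ))
    ∘ₗ mk.symm.toLinearMap

theorem sliceLinear_mk (χ : G →⋆ₙₐ[ℂ] ℂ) (x : F) (y : G) :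
    sliceLinear χ (mk (x ⊗ₜ[ℂ] y)) = χ y • x := rfl

/-- The star-homomorphism `x ⊗ y ↦ χ y • x` defined by a character `χ`. -/
noncomputable def slice (χ : G →⋆ₙₐ[ℂ] ℂ) : AlgTensor F G →⋆ₙₐ[E] F where
  toFun := sliceLinear χ
  map_smul' α z := by
    induction z using ind with
    | zero => simp only [smul_zero, map_zero]
    | add x y hx hy => simp only [smul_add, map_add, hx, hy]
    | tmul a b =>
      rw [smul_mk, sliceLinear_mk, sliceLinear_mk]
      exact smul_comm (χ b) α a
  map_zero' := map_zero _
  map_add' := map_add _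
  map_mul' z z' := by
    induction z using ind with
    | zero => simp only [zero_mul, map_zero]
    | add x y hx hy => simp only [add_mul, map_add, hx, hy]
    | tmul a b =>
      induction z' using ind with
      | zero => simp only [mul_zero, map_zero]
      | add x y hx hy => simp only [mul_add, map_add, hx, hy]
      | tmul c d =>
        rw [mk_tmul_mul, sliceLinear_mk, sliceLinear_mk, sliceLinear_mk, map_mul,
          smul_mul_smul_comm]
  map_star' z := by
    induction z using ind with
    | zero => simp only [star_zero, map_zero]
    | add x y hx hy => simp only [star_add, map_add, hx, hy]
    | tmul a b => rw [star_mk_tmul, sliceLinear_mk, sliceLinear_mk, map_star, star_smul]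

theorem slice_mk (χ : G →⋆ₙₐ[ℂ] ℂ) (x : F) (y : G) :
    slice χ (mk (x ⊗ₜ[ℂ] y)) = χ y • x := rfl

end Slice

end AlgTensor

namespace HilbertRep

variable {A B : Type u} [NonUnitalCStarAlgebra A] [NonUnitalCStarAlgebra B]

/-- The representation of `B` by the scalars `χ y` on a given Hilbert space. -/
noncomputable def ofCharacter (χ : B →⋆ₙₐ[ℂ] ℂ) (H : Type u) [NormedAddCommGroup H]
    [InnerProductSpace ℂ H] [CompleteSpace H] : HilbertRep B where
  space := H
  rep :=
    { toFun := fun y => χ y • 1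
      map_smul' := fun c y => by rw [map_smul, smul_assoc]; rfl
      map_zero' := by rw [map_zero, zero_smul]
      map_add' := fun x y => by rw [map_add, add_smul]
      map_mul' := fun x y => by rw [map_mul, smul_mul_smul_comm, one_mul]
      map_star' := fun x => by rw [map_star, star_smul, star_one] }

/-- On vectors `ξ ⊗ η` with `‖η‖ = 1`, the operator `S ⊗ 1` acts as `S` does on `ξ`. Nontriviality
of the second space provides `η`. -/
theorem norm_le_norm_opTensor_one (π : HilbertRep A) (ρ : HilbertRep B) [Nontrivial ρ.space]
    (S : π.space →L[ℂ] π.space) : ‖S‖ ≤ ‖opTensor π ρ S 1‖ := by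
  obtain ⟨η, hη⟩ := exists_norm_eq ρ.space zero_le_one
  refine ContinuousLinearMap.opNorm_le_bound _ (norm_nonneg _) fun ξ => ?_
  have h := (opTensor π ρ S 1).le_opNorm (toSpace π ρ (ξ ⊗ₜ η))
  rw [opTensor_toSpace, LinearIsometry.norm_map, LinearIsometry.norm_map] at h
  simpa [TensorProduct.norm_tmul, hη] using h

end HilbertRep

namespace AlgTensor

variable {E : Type v} [CommCStarAlgebra E] {F : ECStarAlg.{u} E} {G : Type u}
  [NonUnitalCStarAlgebra G]

/-- A scalar can move between the legs: `π x ⊗ χ y = π (χ y • x) ⊗ 1`. Thus the slice map is visible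
in one of the representations over which the spatial norm is a supremum. -/
theorem rep_ofCharacter (π : HilbertRep F) (χ : G →⋆ₙₐ[ℂ] ℂ) (H : Type u) [NormedAddCommGroup H]
    [InnerProductSpace ℂ H] [CompleteSpace H] (z : AlgTensor F G) :
    rep π (HilbertRep.ofCharacter χ H) z
      = HilbertRep.opTensor π (HilbertRep.ofCharacter χ H) (π.rep (slice χ z)) 1 := by
  induction z using ind with
  | zero =>
    rw [map_zero, map_zero, map_zero]
    -- Homogeneity with the scalar 0 gives `0 ⊗ 1 = 0`.
    have h := HilbertRep.opTensor_smul_left π (HilbertRep.ofCharacter χ H) 0 0 1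
    rw [zero_smul, zero_smul] at h
    exact h.symm
  | add x y hx hy => rw [map_add, map_add, map_add, hx, hy, HilbertRep.opTensor_add_left]
  | tmul a b =>
    rw [rep_tmul, slice_mk, map_smul, HilbertRep.opTensor_smul_left]
    exact HilbertRep.opTensor_smul_right _ _ _ _ _

/-- Take `π` attaining the norm of the slice of `z` and let `G` act through `χ`. Then `π ⊗ χ` maps
`z` to an amplification of `π` of the slice, and its norm is at most the spatial norm of `z`. -/
theorem norm_slice_le (χ : G →⋆ₙₐ[ℂ] ℂ) (z : AlgTensor F G) : ‖slice χ z‖ ≤ ‖z‖ := by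
  obtain ⟨π, hπ⟩ := HilbertRep.exists_norm_le (slice χ z)
  -- `G` is made to act on `π.space` itself, a space already in the right universe. If that space is
  -- zero, the slice has norm 0.
  rcases subsingleton_or_nontrivial π.space with h | h
  · have h0 : π.rep (slice χ z) = 0 := Subsingleton.elim _ _
    rw [h0, norm_zero] at hπ
    exact hπ.trans (norm_nonneg z)
  · have : Nontrivial (HilbertRep.ofCharacter χ π.space).space := h
    refine hπ.trans ((HilbertRep.norm_le_norm_opTensor_one π
      (HilbertRep.ofCharacter χ π.space) _).trans ?_)
    rw [← rep_ofCharacter]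
    exact le_norm _ _ z

end AlgTensor

/-! ## Tensor products with a split extension by `ℂ` -/

/-- `0 ⟶ A ⟶ B ⟶ ℂ ⟶ 0` is exact, and `e` is a unit element of `B`. -/
structure IsUnitization {A B : Type u} [NonUnitalCStarAlgebra A] [NonUnitalCStarAlgebra B]
    (ι : A →⋆ₙₐ[ℂ] B) (χ : B →⋆ₙₐ[ℂ] ℂ) (e : B) : Prop where
  injective : Function.Injective ι
  exact : Function.Exact ι χ
  unit : IsUnitElement e
  map_unit : χ e = 1

namespace IsUnitization

variable {A B : Type u} [NonUnitalCStarAlgebra A] [NonUnitalCStarAlgebra B]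
  {ι : A →⋆ₙₐ[ℂ] B} {χ : B →⋆ₙₐ[ℂ] ℂ} {e : B}

theorem exists_apply_eq_sub (h : IsUnitization ι χ e) (b : B) : ∃ a, ι a = b - χ b • e :=
  (h.exact _).mp (by rw [map_sub, map_smul, h.map_unit, smul_eq_mul, mul_one, sub_self])

/-- The component in `A` of an element of `B`. -/
noncomputable def retract (h : IsUnitization ι χ e) (b : B) : A :=
  (h.exists_apply_eq_sub b).choose

theorem apply_retract (h : IsUnitization ι χ e) (b : B) : ι (h.retract b) = b - χ b • e :=
  (h.exists_apply_eq_sub b).choose_spec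

theorem retract_apply (h : IsUnitization ι χ e) (a : A) : h.retract (ι a) = a :=
  h.injective (by rw [h.apply_retract, h.exact.apply_apply_eq_zero, zero_smul, sub_zero])

/-- The extension to `B` of a star-homomorphism from `A` to a unital C*-algebra. -/
noncomputable def extend (h : IsUnitization ι χ e) {R : Type u} [CStarAlgebra R]
    (ρ : A →⋆ₙₐ[ℂ] R) : B →⋆ₙₐ[ℂ] R where
  toFun b := ρ (h.retract b) + χ b • 1
  map_smul' c b := by
    have : h.retract (c • b) = c • h.retract b := h.injective (by
      rw [map_smul, h.apply_retract, h.apply_retract, map_smul, smul_sub, smul_assoc])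
    rw [this, map_smul, map_smul, smul_add, smul_assoc]
    rfl
  map_zero' := by
    have : h.retract 0 = 0 := h.injective (by
      rw [h.apply_retract, map_zero, map_zero, zero_smul, sub_zero])
    rw [this, map_zero, map_zero, zero_smul, add_zero]
  map_add' b c := by
    have : h.retract (b + c) = h.retract b + h.retract c := h.injective (by
      rw [map_add, h.apply_retract, h.apply_retract, h.apply_retract, map_add, add_smul]
      abel)
    rw [this, map_add, map_add, add_smul]
    abel
  map_mul' b c := by
    -- This is the product rule `(a + β e)(c + γ e) = (a c + γ a + β c) + β γ e` of a unitization.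
    have : h.retract (b * c) = h.retract b * h.retract c + χ c • h.retract b
        + χ b • h.retract c := h.injective (by
      simp only [map_add, map_mul, map_smul, h.apply_retract, sub_mul, mul_sub, smul_mul_assoc,
        mul_smul_comm, (h.unit _).1, (h.unit _).2, smul_sub, smul_smul, mul_comm (χ c)]
      abel)
    rw [this]
    simp only [map_add, map_mul, map_smul, add_mul, mul_add, smul_mul_assoc, mul_smul_comm,
      one_mul, mul_one, smul_smul, smul_add]
    rw [mul_comm (χ b)]
    abel
  map_star' b := by
    have : h.retract (star b) = star (h.retract b) := h.injective (by
      rw [map_star, h.apply_retract, h.apply_retract, map_star, star_sub, star_smul,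
        h.unit.star_eq])
    rw [this, map_star, map_star, star_add, star_smul, star_one]

theorem extend_apply (h : IsUnitization ι χ e) {R : Type u} [CStarAlgebra R]
    (ρ : A →⋆ₙₐ[ℂ] R) (a : A) : h.extend ρ (ι a) = ρ a := by
  change ρ (h.retract (ι a)) + χ (ι a) • 1 = ρ a
  rw [h.retract_apply, h.exact.apply_apply_eq_zero, zero_smul, add_zero]

/-- Each representation `ρ` of `A` extends to a representation of `B` on the same space, so `π ⊗ ρ`
is the restriction of a representation already counted in the norm of `F ⊙ B`. -/
theorem norm_le_norm_map {E : Type v} [CommCStarAlgebra E] {F : ECStarAlg.{u} E}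
    (h : IsUnitization ι χ e) (z : AlgTensor F A) :
    ‖z‖ ≤ ‖AlgTensor.map (NonUnitalStarAlgHom.id E F) ι z‖ := by
  refine AlgTensor.norm_le (norm_nonneg _) fun π ρ => ?_
  let ρ' : HilbertRep B := ⟨ρ.space, h.extend ρ.rep⟩
  have hz : AlgTensor.rep π ρ z
      = AlgTensor.rep π ρ' (AlgTensor.map (NonUnitalStarAlgHom.id E F) ι z) := by
    induction z using AlgTensor.ind with
    | zero => rw [map_zero, map_zero, map_zero]; rfl
    | add x y hx hy => rw [map_add, map_add, map_add, hx, hy]; rfl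
    | tmul a b =>
      rw [AlgTensor.map_mk, AlgTensor.rep_tmul, AlgTensor.rep_tmul, h.extend_apply]; rfl
  rw [hz]
  exact AlgTensor.le_norm π ρ' _

end IsUnitization

/-! ### Morphisms on tensor products and slice maps -/

namespace ECStarAlg

open CategoryTheory

variable {E : Type v} [CommCStarAlgebra E]

/-- Star-homomorphisms of C*-algebras are automatically contractive. -/
theorem continuous_hom {F G : ECStarAlg.{u} E} (φ : F ⟶ G) : Continuous (hom φ) :=
  (AddMonoidHomClass.lipschitz_of_bound (toComplexHom (hom φ)) 1
    (by simpa using NonUnitalStarAlgHom.norm_apply_le (toComplexHom (hom φ)))).continuous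

variable {F F' : ECStarAlg.{u} E} {G G' : Type u} [NonUnitalCStarAlgebra G]
  [NonUnitalCStarAlgebra G']

theorem morphism_ext {F G : ECStarAlg.{u} E} {φ ψ : F ⟶ G} (h : ∀ x, hom φ x = hom ψ x) :
    φ = ψ :=
  NonUnitalStarAlgHom.ext h

@[elab_as_elim]
theorem tensor_ind {p : F.tensor G → Prop} (z : F.tensor G) (closed : IsClosed {z | p z})
    (zero : p 0) (tmul : ∀ x y, p (tmul x y)) (add : ∀ x y, p x → p y → p (x + y)) : p z := by
  refine CStarCompletion.ind z closed fun z => ?_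
  induction z using AlgTensor.ind with
  | zero => rw [CStarCompletion.of_zero]; exact zero
  | tmul a b => exact tmul a b
  | add x y hx hy => rw [CStarCompletion.of_add]; exact add _ _ hx hy

/-- Elementary tensors span a dense subspace, and morphisms are continuous. -/
theorem tensor_hom_ext {H : ECStarAlg.{u} E} {φ ψ : F.tensor G ⟶ H}
    (h : ∀ x y, hom φ (tmul x y) = hom ψ (tmul x y)) : φ = ψ := by
  refine morphism_ext fun z => ?_
  induction z using tensor_ind with
  | closed => exact isClosed_eq (continuous_hom φ) (continuous_hom ψ)
  | zero => rw [map_zero, map_zero]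
  | tmul x y => exact h x y
  | add x y hx hy => rw [map_add, map_add, hx, hy]

theorem hom_comp_apply {F G H : ECStarAlg.{u} E} (φ : F ⟶ G) (ψ : G ⟶ H) (x : F) :
    hom (φ ≫ ψ) x = hom ψ (hom φ x) := rfl

theorem hom_id_apply (x : F) : hom (𝟙 F) x = x := rfl

theorem tmul_smul (c : ℂ) (x : F) (y : G) : tmul x (c • y) = tmul (c • x) y :=
  congrArg (fun z => CStarCompletion.of (AlgTensor.mk z)) (TensorProduct.smul_tmul c x y).symm

theorem tmul_sub (x : F) (y y' : G) : tmul x (y - y') = tmul x y - tmul x y' := by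
  have h := CStarCompletion.of_add (AlgTensor.mk (x ⊗ₜ[ℂ] (y - y'))) (AlgTensor.mk (x ⊗ₜ[ℂ] y'))
  rw [← map_add, ← TensorProduct.tmul_add, sub_add_cancel] at h
  exact eq_sub_of_add_eq h.symm

/-- The slice map `F ⊗ G ⟶ F`, `x ⊗ y ↦ χ y • x`, defined by a character `χ` of `G`. -/
noncomputable def tensorSlice (F : ECStarAlg.{u} E) (χ : G →⋆ₙₐ[ℂ] ℂ) : F.tensor G ⟶ F :=
  ofHom (F := F.tensor G) (CStarCompletion.lift (AlgTensor.slice χ) (AlgTensor.norm_slice_le χ))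

theorem tensorSlice_tmul (χ : G →⋆ₙₐ[ℂ] ℂ) (x : F) (y : G) :
    hom (F.tensorSlice χ) (tmul x y) = χ y • x :=
  CStarCompletion.lift_of _ (AlgTensor.norm_slice_le χ) _

theorem tensorMap_comp_tensorMap {F'' : ECStarAlg.{u} E} {G'' : Type u} [NonUnitalCStarAlgebra G'']
    (φ : F ⟶ F') (φ' : F' ⟶ F'') (ψ : G →⋆ₙₐ[ℂ] G') (ψ' : G' →⋆ₙₐ[ℂ] G'') :
    tensorMap φ ψ ≫ tensorMap φ' ψ' = tensorMap (φ ≫ φ') (ψ'.comp ψ) :=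
  tensor_hom_ext fun x y => by
    rw [hom_comp_apply, tensorMap_tmul, tensorMap_tmul, tensorMap_tmul]; rfl

theorem tensorMap_comp_tensorSlice (φ : F ⟶ F') (χ : G →⋆ₙₐ[ℂ] ℂ) :
    tensorMap φ (NonUnitalStarAlgHom.id ℂ G) ≫ F'.tensorSlice χ = F.tensorSlice χ ≫ φ :=
  tensor_hom_ext fun x y => by
    rw [hom_comp_apply, hom_comp_apply, tensorMap_tmul, tensorSlice_tmul, tensorSlice_tmul]
    exact (map_smul (toComplexHom (hom φ)) (χ y) x).symm

theorem tensorUnit_comp_tensorMap (φ : F ⟶ F') {e : G} (he : IsUnitElement e) :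
    F.tensorUnit e he ≫ tensorMap φ (NonUnitalStarAlgHom.id ℂ G) = φ ≫ F'.tensorUnit e he :=
  morphism_ext fun x => tensorMap_tmul φ _ x e

end ECStarAlg

/-! ### Exactness of tensor products with a unitization -/

namespace IsUnitization

open CategoryTheory ECStarAlg

variable {E : Type v} [CommCStarAlgebra E] {A B : Type u} [NonUnitalCStarAlgebra A]
  [NonUnitalCStarAlgebra B] {ι : A →⋆ₙₐ[ℂ] B} {χ : B →⋆ₙₐ[ℂ] ℂ} {e : B}

theorem tensorUnit_comp_tensorSlice (h : IsUnitization ι χ e) (F : ECStarAlg.{u} E) :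
    F.tensorUnit e h.unit ≫ F.tensorSlice χ = 𝟙 F :=
  morphism_ext fun x => by
    rw [hom_comp_apply, tensorUnit_apply, tensorSlice_tmul, h.map_unit, one_smul, hom_id_apply]

/-- On the algebraic tensor product the two inequalities `AlgTensor.norm_map_le` and
`norm_le_norm_map` give equality of norms; density does the rest. -/
theorem isometry_tensorMap (h : IsUnitization ι χ e) (F : ECStarAlg.{u} E) :
    Isometry (hom (tensorMap (𝟙 F) ι)) := by
  refine AddMonoidHomClass.isometry_of_norm _ fun z => ?_
  refine CStarCompletion.ind (p := fun z => ‖hom (tensorMap (𝟙 F) ι) z‖ = ‖z‖) z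
    (isClosed_eq ?_ continuous_norm) fun z => ?_
  · exact continuous_norm.comp (continuous_hom (tensorMap (𝟙 F) ι))
  · have h1 : hom (tensorMap (𝟙 F) ι) (CStarCompletion.of z)
        = CStarCompletion.of (AlgTensor.map (NonUnitalStarAlgHom.id E F) ι z) :=
      CStarCompletion.map_of _ (AlgTensor.norm_map_le _ ι) z
    rw [h1]
    refine (CStarCompletion.norm_of _).trans (Eq.trans ?_ (CStarCompletion.norm_of _).symm)
    exact le_antisymm (AlgTensor.norm_map_le _ _ z) (h.norm_le_norm_map z)

/-- This is the decomposition of `F ⊗ B` into `F ⊗ A` and `F ⊗ e`. It need only be checked on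
elementary tensors, where `x ⊗ y - χ y • x ⊗ e = x ⊗ (y - χ y • e)`. -/
theorem exists_sub_eq (h : IsUnitization ι χ e) (F : ECStarAlg.{u} E) (z : F.tensor B) :
    ∃ a, hom (tensorMap (𝟙 F) ι) a
      = z - hom (F.tensorUnit e h.unit) (hom (F.tensorSlice χ) z) := by
  induction z using tensor_ind with
  | closed =>
    -- An isometry out of a complete space has closed range, so the condition on `z` passes to
    -- limits.
    exact (h.isometry_tensorMap F).isClosedEmbedding.isClosed_range.preimage (continuous_id.sub
      ((continuous_hom (F.tensorUnit e h.unit)).comp (continuous_hom (F.tensorSlice χ))))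
  | zero => exact ⟨0, by simp only [map_zero, sub_zero]⟩
  | tmul x y =>
    refine ⟨tmul x (h.retract y), ?_⟩
    rw [tensorMap_tmul, h.apply_retract, tensorSlice_tmul, tensorUnit_apply, hom_id_apply, tmul_sub,
      tmul_smul]
  | add x y hx hy =>
    obtain ⟨a, ha⟩ := hx
    obtain ⟨b, hb⟩ := hy
    exact ⟨a + b, by rw [map_add, map_add, map_add, ha, hb]; abel⟩

theorem tensorSlice_tensorMap (h : IsUnitization ι χ e) {F : ECStarAlg.{u} E} (a : F.tensor A) :
    hom (F.tensorSlice χ) (hom (tensorMap (𝟙 F) ι) a) = 0 := by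
  induction a using tensor_ind with
  | closed =>
    exact isClosed_eq ((continuous_hom (F.tensorSlice χ)).comp
      (continuous_hom (tensorMap (𝟙 F) ι))) continuous_const
  | zero => rw [map_zero, map_zero]
  | tmul x y =>
    rw [tensorMap_tmul, tensorSlice_tmul, h.exact.apply_apply_eq_zero, zero_smul]
  | add x y hx hy => rw [map_add, map_add, hx, hy, add_zero]

theorem tensorSlice_tensorUnit (h : IsUnitization ι χ e) {F : ECStarAlg.{u} E} (x : F) :
    hom (F.tensorSlice χ) (hom (F.tensorUnit e h.unit) x) = x := by
  rw [← hom_comp_apply, h.tensorUnit_comp_tensorSlice, hom_id_apply]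

/-- The spatial tensor product preserves the exactness of `0 ⟶ A ⟶ B ⟶ ℂ ⟶ 0`. -/
theorem shortExact_tensor (h : IsUnitization ι χ e) (F : ECStarAlg.{u} E) :
    ShortExact (tensorMap (𝟙 F) ι) (F.tensorSlice χ) where
  injective := (h.isometry_tensorMap F).injective
  exact z := by
    refine ⟨fun hz => ?_, ?_⟩
    · obtain ⟨a, ha⟩ := h.exists_sub_eq F z
      exact ⟨a, by rw [ha, hz, map_zero, sub_zero]⟩
    · rintro ⟨a, rfl⟩
      exact h.tensorSlice_tensorMap a
  surjective x := ⟨_, h.tensorSlice_tensorUnit x⟩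

theorem exists_eq_add (h : IsUnitization ι χ e) {F : ECStarAlg.{u} E} (z : F.tensor B) :
    ∃ a, z = hom (tensorMap (𝟙 F) ι) a
      + hom (F.tensorUnit e h.unit) (hom (F.tensorSlice χ) z) := by
  obtain ⟨a, ha⟩ := h.exists_sub_eq F z
  exact ⟨a, by rw [ha, sub_add_cancel]⟩

theorem tensorMap_comm {F F' : ECStarAlg.{u} E} (φ : F ⟶ F') :
    tensorMap φ (NonUnitalStarAlgHom.id ℂ A) ≫ tensorMap (𝟙 F') ι
      = tensorMap (𝟙 F) ι ≫ tensorMap φ (NonUnitalStarAlgHom.id ℂ B) := by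
  rw [tensorMap_comp_tensorMap, tensorMap_comp_tensorMap, Category.comp_id, Category.id_comp]
  rfl

/-- If tensoring with `A` preserves the exactness of a sequence, then so does tensoring
with `B`. -/
theorem shortExact_tensorMap (h : IsUnitization ι χ e) {F₁ F₂ F₃ : ECStarAlg.{u} E}
    {φ₁ : F₁ ⟶ F₂} {φ₂ : F₂ ⟶ F₃} (hφ : ShortExact φ₁ φ₂)
    (hA : ShortExact (tensorMap φ₁ (NonUnitalStarAlgHom.id ℂ A))
      (tensorMap φ₂ (NonUnitalStarAlgHom.id ℂ A))) :
    ShortExact (tensorMap φ₁ (NonUnitalStarAlgHom.id ℂ B))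
      (tensorMap φ₂ (NonUnitalStarAlgHom.id ℂ B)) := by
  -- The next three facts say that `φ ⊗ id` respects the splitting of `F ⊗ B`, acting as `φ ⊗ id` on
  -- `F ⊗ A` and as `φ` on `F`. Exactness is then checked in each summand.
  have slice {F F' : ECStarAlg.{u} E} (φ : F ⟶ F') (z : F.tensor B) :
      hom (F'.tensorSlice χ) (hom (tensorMap φ (NonUnitalStarAlgHom.id ℂ B)) z)
        = hom φ (hom (F.tensorSlice χ) z) := by
    rw [← hom_comp_apply, tensorMap_comp_tensorSlice, hom_comp_apply]
  have incl {F F' : ECStarAlg.{u} E} (φ : F ⟶ F') (a : F.tensor A) :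
      hom (tensorMap φ (NonUnitalStarAlgHom.id ℂ B)) (hom (tensorMap (𝟙 F) ι) a)
        = hom (tensorMap (𝟙 F') ι) (hom (tensorMap φ (NonUnitalStarAlgHom.id ℂ A)) a) := by
    rw [← hom_comp_apply, ← tensorMap_comm, hom_comp_apply]
  have unit {F F' : ECStarAlg.{u} E} (φ : F ⟶ F') (x : F) :
      hom (tensorMap φ (NonUnitalStarAlgHom.id ℂ B)) (hom (F.tensorUnit e h.unit) x)
        = hom (F'.tensorUnit e h.unit) (hom φ x) := by
    rw [← hom_comp_apply, tensorUnit_comp_tensorMap, hom_comp_apply]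
  refine ⟨(injective_iff_map_eq_zero _).mpr fun z hz => ?_, fun z => ⟨fun hz => ?_, ?_⟩,
    fun z => ?_⟩
  · have hx : hom (F₁.tensorSlice χ) z = 0 :=
      (injective_iff_map_eq_zero _).mp hφ.injective _ (by rw [← slice, hz, map_zero])
    obtain ⟨a, ha⟩ := h.exists_eq_add z
    rw [hx, map_zero, add_zero] at ha
    rw [ha, incl] at hz
    have ha0 := (injective_iff_map_eq_zero _).mp hA.injective _
      ((injective_iff_map_eq_zero _).mp (h.isometry_tensorMap F₂).injective _ hz)
    rw [ha, ha0, map_zero]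
  · obtain ⟨a, ha⟩ := h.exists_eq_add z
    have hx : hom φ₂ (hom (F₂.tensorSlice χ) z) = 0 := by rw [← slice, hz, map_zero]
    rw [ha, map_add, unit, hx, map_zero, add_zero, incl] at hz
    obtain ⟨a', rfl⟩ := (hA.exact a).mp
      ((injective_iff_map_eq_zero _).mp (h.isometry_tensorMap F₃).injective _ hz)
    obtain ⟨x', hx'⟩ := (hφ.exact _).mp hx
    exact ⟨hom (tensorMap (𝟙 F₁) ι) a' + hom (F₁.tensorUnit e h.unit) x', by
      rw [map_add, incl, unit, hx', ← ha]⟩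
  · rintro ⟨y, rfl⟩
    obtain ⟨a, ha⟩ := h.exists_eq_add y
    rw [ha, map_add, map_add, incl, incl, unit, unit, hA.exact.apply_apply_eq_zero,
      hφ.exact.apply_apply_eq_zero, map_zero, map_zero, add_zero]
  · obtain ⟨a, ha⟩ := h.exists_eq_add z
    obtain ⟨a', rfl⟩ := hA.surjective a
    obtain ⟨x', hx'⟩ := hφ.surjective (hom (F₃.tensorSlice χ) z)
    exact ⟨hom (tensorMap (𝟙 F₂) ι) a' + hom (F₂.tensorUnit e h.unit) x', by
      rw [map_add, incl, unit, hx', ← ha]⟩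

end IsUnitization

/-! ## The one-point compactification -/

section OnePoint

open Topology

variable {Ω : Type u} [TopologicalSpace Ω] [T2Space Ω]

/-- The restriction to `Ω` of a function on the one-point compactification that vanishes
at `∞`. -/
def restrictOfInfty {R : Type*} [TopologicalSpace R] [Zero R] (g : C(OnePoint Ω, R))
    (hg : g OnePoint.infty = 0) : C₀(Ω, R) where
  toFun x := g x
  continuous_toFun := g.continuous.comp OnePoint.continuous_coe
  zero_at_infty' := by
    -- Continuity at `∞` is convergence along complements of closed compact sets; in a Hausdorff
    -- space every compact set is closed.
    have h := OnePoint.continuousAt_infty'.mp g.continuous.continuousAt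
    rwa [hg, Filter.coclosedCompact_eq_cocompact] at h

variable (Ω)

/-- The extension by `0` at `∞` of complex functions vanishing at infinity. -/
noncomputable def zeroAtInftyExtend : C₀(Ω, ℂ) →⋆ₙₐ[ℂ] C₀(OnePoint Ω, ℂ) where
  toFun f := ZeroAtInftyContinuousMap.ContinuousMap.liftZeroAtInfty
    (OnePoint.continuousMapMk f.toContinuousMap 0 (by
      rw [Filter.coclosedCompact_eq_cocompact]; exact f.zero_at_infty'))
  map_smul' c f := ZeroAtInftyContinuousMap.ext fun x => by
    cases x using OnePoint.rec with
    | infty => exact (smul_zero c).symm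
    | coe x => rfl
  map_zero' := ZeroAtInftyContinuousMap.ext fun x => by
    cases x using OnePoint.rec <;> rfl
  map_add' f g := ZeroAtInftyContinuousMap.ext fun x => by
    cases x using OnePoint.rec with
    | infty => exact (add_zero (0 : ℂ)).symm
    | coe x => rfl
  map_mul' f g := ZeroAtInftyContinuousMap.ext fun x => by
    cases x using OnePoint.rec with
    | infty => exact (mul_zero (0 : ℂ)).symm
    | coe x => rfl
  map_star' f := ZeroAtInftyContinuousMap.ext fun x => by
    cases x using OnePoint.rec with
    | infty => exact (star_zero ℂ).symm
    | coe x => rfl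

/-- The character `f ↦ f ∞`. -/
noncomputable def evalInfty : C₀(OnePoint Ω, ℂ) →⋆ₙₐ[ℂ] ℂ where
  toFun f := f OnePoint.infty
  map_smul' _ _ := rfl
  map_zero' := rfl
  map_add' _ _ := rfl
  map_mul' _ _ := rfl
  map_star' _ := rfl

/-- A continuous function on `Ω*` that vanishes at `∞` is the extension by 0 of its restriction to
`Ω`. Since `Ω*` is compact, constants belong to `C₀(Ω*, ℂ)`, and the constant 1 is its unit. -/
theorem isUnitization_zeroAtInftyExtend : IsUnitization (zeroAtInftyExtend Ω) (evalInfty Ω)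
    (ZeroAtInftyContinuousMap.ContinuousMap.liftZeroAtInfty
      (ContinuousMap.const (OnePoint Ω) (1 : ℂ))) where
  injective f g h := ZeroAtInftyContinuousMap.ext fun x =>
    congrArg (fun k : C₀(OnePoint Ω, ℂ) => k x) h
  exact g := by
    refine ⟨fun hg => ⟨restrictOfInfty g.toContinuousMap hg, ?_⟩, ?_⟩
    · refine ZeroAtInftyContinuousMap.ext fun x => ?_
      cases x using OnePoint.rec with
      | infty => exact Eq.symm hg
      | coe x => rfl
    · rintro ⟨f, rfl⟩
      rfl
  unit f := ⟨ZeroAtInftyContinuousMap.ext fun x => one_mul (f x),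
    ZeroAtInftyContinuousMap.ext fun x => mul_one (f x)⟩
  map_unit := rfl

end OnePoint

/-! ### The evaluation sequence of `C(Ω*, F)` -/

namespace ECStarAlg

open CategoryTheory

variable {E : Type v} [CommCStarAlgebra E]

/-- The evaluation at a point of a compact space. -/
noncomputable def evaluation {X : Type u} [TopologicalSpace X] [CompactSpace X]
    (x : X) (F : ECStarAlg.{u} E) : continuousFunctions X F ⟶ F :=
  ofHom (F := continuousFunctions X F) (G := F)
    { toFun := fun f => (show C(X, F) from f) x
      map_smul' := fun _ _ => rfl
      map_zero' := rfl
      map_add' := fun _ _ => rfl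
      map_mul' := fun _ _ => rfl
      map_star' := fun _ => rfl }

theorem constants_comp_evaluation {X : Type u} [TopologicalSpace X] [CompactSpace X] (x : X)
    (F : ECStarAlg.{u} E) : constants X F ≫ evaluation x F = 𝟙 F := rfl

/-- Split by the constant functions, this sequence yields part (a). -/
theorem shortExact_inclusion (Ω : Type u) [TopologicalSpace Ω] [T2Space Ω] (F : ECStarAlg.{u} E) :
    ShortExact (inclusion Ω F) (evaluation OnePoint.infty F) where
  injective f g h := ZeroAtInftyContinuousMap.ext fun x =>
    congrArg (fun k : C(OnePoint Ω, F) => k x) h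
  exact g := by
    refine ⟨fun hg => ⟨restrictOfInfty (R := F) g hg, ?_⟩, ?_⟩
    · refine ContinuousMap.ext fun x => ?_
      cases x using OnePoint.rec with
      | infty => exact Eq.symm hg
      | coe x => rfl
    · rintro ⟨f, rfl⟩
      rfl
  surjective x := ⟨hom (constants (OnePoint Ω) F) x, rfl⟩

theorem mapHom_comp_apply (T : ECStarAlg.{u} E ⥤ AddCommGrpCat.{w}) {F G H : ECStarAlg.{u} E}
    (φ : F ⟶ G) (ψ : G ⟶ H) (a : T.obj F) :
    mapHom T (φ ≫ ψ) a = mapHom T ψ (mapHom T φ a) := by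
  rw [mapHom, T.map_comp]; rfl

end ECStarAlg

/-! ## Split exact sequences in K-theory -/

namespace KTheory

open CategoryTheory ECStarAlg

variable {E : Type v} [CommCStarAlgebra E] (K : KTheory.{u, v, w} E)

/-- A split exact sequence decomposes the K-groups of its middle term. -/
noncomputable def splitEquiv (i : ZMod 2) {F G H : ECStarAlg.{u} E} {φ : F ⟶ G} {ψ : G ⟶ H}
    {σ : H ⟶ G} (h : ShortExact φ ψ) (hσ : σ ≫ ψ = 𝟙 H) :
    ((K.K i).obj F × (K.K i).obj H) ≃+ (K.K i).obj G :=
  AddEquiv.ofBijective ((mapHom (K.K i) φ).coprod (mapHom (K.K i) σ)) (by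
    obtain ⟨h1, h2, h3⟩ := K.split_exact i φ ψ σ h hσ
    constructor
    · refine (injective_iff_map_eq_zero _).mpr fun x hx => ?_
      rw [AddMonoidHom.coprod_apply] at hx
      have hb : x.2 = 0 := by
        have := congrArg (mapHom (K.K i) ψ) hx
        rwa [map_add, h2.apply_apply_eq_zero, h3, zero_add, map_zero] at this
      rw [hb, map_zero, add_zero] at hx
      exact Prod.ext ((injective_iff_map_eq_zero _).mp h1 _ hx) hb
    · intro z
      -- Removing the part of `z` that comes from `H` leaves an element of the kernel of `ψ`, which
      -- exactness lifts to `F`.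
      obtain ⟨a, ha⟩ := (h2 (z - mapHom (K.K i) σ (mapHom (K.K i) ψ z))).mp (by
        rw [map_sub, h3, sub_self])
      exact ⟨(a, mapHom (K.K i) ψ z), by rw [AddMonoidHom.coprod_apply, ha, sub_add_cancel]⟩)

theorem splitEquiv_apply (i : ZMod 2) {F G H : ECStarAlg.{u} E} {φ : F ⟶ G} {ψ : G ⟶ H}
    {σ : H ⟶ G} (h : ShortExact φ ψ) (hσ : σ ≫ ψ = 𝟙 H) (a : (K.K i).obj F) (b : (K.K i).obj H) :
    K.splitEquiv i h hσ (a, b) = mapHom (K.K i) φ a + mapHom (K.K i) σ b := rfl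

end KTheory

/-! ## `Υ`-structures on unitizations -/

/-- Splitting off the first coordinate of the first factor. -/
def AddEquiv.finSuccFunProd (M N : Type*) [AddCommGroup M] [AddCommGroup N] (p q : ℕ) :
    ((Fin (p + 1) → M) × (Fin q → N)) ≃+ ((Fin p → M) × (Fin q → N)) × M where
  toFun x := ((fun j => x.1 j.succ, x.2), x.1 0)
  invFun y := (Fin.cons y.2 y.1.1, y.1.2)
  left_inv x := Prod.ext (Fin.cons_self_tail x.1) rfl
  right_inv _ := rfl
  map_add' _ _ := rfl

namespace UpsilonIso

open CategoryTheory ECStarAlg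

variable {E : Type v} [CommCStarAlgebra E] {K : KTheory.{u, v, w} E} {A B : Type u}
  [NonUnitalCStarAlgebra A] [NonUnitalCStarAlgebra B] {ι : A →⋆ₙₐ[ℂ] B} {χ : B →⋆ₙₐ[ℂ] ℂ} {e : B}
  {p q : ℕ}

/-- The isomorphisms of the `Υ`-structure on the unitization. -/
noncomputable def unitizationEquiv (Φ : UpsilonIso K A p q) (h : IsUnitization ι χ e) (i : ZMod 2)
    (F : ECStarAlg.{u} E) :
    ((Fin (p + 1) → (K.K i).obj F) × (Fin q → (K.K (i + 1)).obj F)) ≃+ (K.K i).obj (F.tensor B) :=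
  ((AddEquiv.finSuccFunProd _ _ p q).trans ((Φ.iso i F).prodCongr (AddEquiv.refl _))).trans
    (K.splitEquiv i (h.shortExact_tensor F) (h.tensorUnit_comp_tensorSlice F))

/-- Coordinate 0 carries the new summand coming from the unit; the remaining coordinates, shifted
down by one, are those of `Φ`. -/
theorem unitizationEquiv_apply (Φ : UpsilonIso K A p q) (h : IsUnitization ι χ e) (i : ZMod 2)
    (F : ECStarAlg.{u} E) (x : (Fin (p + 1) → (K.K i).obj F) × (Fin q → (K.K (i + 1)).obj F)) :
    Φ.unitizationEquiv h i F x
      = mapHom (K.K i) (tensorMap (𝟙 F) ι) (Φ.iso i F (fun j => x.1 j.succ, x.2))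
        + mapHom (K.K i) (F.tensorUnit e h.unit) (x.1 0) := rfl

/-- The `Υ`-structure of type `(p + 1, q)` on a unitization, obtained from one of type `(p, q)`. -/
noncomputable def unitization (Φ : UpsilonIso K A p q) (h : IsUnitization ι χ e) :
    UpsilonIso K B (p + 1) q where
  iso := Φ.unitizationEquiv h
  natural i F F' φ x := by
    rw [unitizationEquiv_apply, unitizationEquiv_apply, map_add, ← mapHom_comp_apply,
      ← mapHom_comp_apply, tensorUnit_comp_tensorMap, ← IsUnitization.tensorMap_comm,
      mapHom_comp_apply, mapHom_comp_apply, Φ.natural]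

/-- The sequence tensored with `B` receives morphisms of exact sequences both from the one tensored
with `A` and, through `x ↦ x ⊗ e`, from the original one. Naturality of the index maps handles each
summand, with the hypothesis on `Φ` entering in the first. -/
theorem Intertwines.unitization {Φ : UpsilonIso K A p q} (h : IsUnitization ι χ e)
    {F₁ F₂ F₃ : ECStarAlg.{u} E} {φ₁ : F₁ ⟶ F₂} {φ₂ : F₂ ⟶ F₃} {hφ : ShortExact φ₁ φ₂}
    (hΦ : Φ.Intertwines φ₁ φ₂ hφ) : (Φ.unitization h).Intertwines φ₁ φ₂ hφ := by
  obtain ⟨hA, hδ⟩ := hΦ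
  have hB := h.shortExact_tensorMap hφ hA
  refine ⟨hB, fun i x => ?_⟩
  change K.index i _ _ hB (Φ.unitizationEquiv h i F₃ x) = Φ.unitizationEquiv h (i + 1) F₁ _
  rw [unitizationEquiv_apply, unitizationEquiv_apply, map_add]
  refine congrArg₂ (· + ·) ?_ ?_
  · refine Eq.trans ?_ (congrArg _ (hδ i (fun j => x.1 j.succ, x.2)))
    exact (K.index_natural i _ _ hA _ _ hB _ _ _ (IsUnitization.tensorMap_comm φ₁)
      (IsUnitization.tensorMap_comm φ₂) _).symm
  · exact (K.index_natural i _ _ hφ _ _ hB _ _ _ (tensorUnit_comp_tensorMap φ₁ h.unit).symm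
      (tensorUnit_comp_tensorMap φ₂ h.unit).symm _).symm

end UpsilonIso

/-! ### `Υ`-null algebras and the class `Υ₁` -/

namespace IsUnitization

open CategoryTheory ECStarAlg

variable {E : Type v} [CommCStarAlgebra E] {K : KTheory.{u, v, w} E} {A B : Type u}
  [NonUnitalCStarAlgebra A] [NonUnitalCStarAlgebra B] {ι : A →⋆ₙₐ[ℂ] B} {χ : B →⋆ₙₐ[ℂ] ℂ} {e : B}

/-- In type `(0, 0)` the source of `Φ` is trivial, so only the summand of the unit survives in the
structure on `B`. -/
theorem isUpsilonOne (h : IsUnitization ι χ e) (hA : IsUpsilonNull K A) : IsUpsilonOne K B := by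
  obtain ⟨Φ⟩ := hA
  refine ⟨e, h.unit, Φ.unitization h, fun i F x => ?_⟩
  change Φ.unitizationEquiv h i F x = _
  have h0 : ((fun j => x.1 j.succ, x.2) :
      (Fin 0 → (K.K i).obj F) × (Fin 0 → (K.K (i + 1)).obj F)) = 0 := Subsingleton.elim _ _
  rw [UpsilonIso.unitizationEquiv_apply, h0, map_zero, map_zero, zero_add]

/-- If the unit summand is already all of `Kᵢ(F ⊗ B)`, then each class from `Kᵢ(F ⊗ A)` has the two
decompositions `(a, 0)` and `(0, x)`, and uniqueness forces `a = 0`. -/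
theorem isUpsilonNull (h : IsUnitization ι χ e) (hB : IsUpsilonOne K B) : IsUpsilonNull K A := by
  obtain ⟨e', he', Φ, hΦ⟩ := hB
  -- The unit in the definition of `Υ₁` is arbitrary; it agrees with `e` because units are unique.
  obtain rfl : e' = e := (h.unit e').1.symm.trans (he' e).2
  have hsub : ∀ (i : ZMod 2) (F : ECStarAlg.{u} E) (a : (K.K i).obj (F.tensor A)), a = 0 := by
    intro i F a
    obtain ⟨x, hx⟩ := (Φ.iso i F).surjective (mapHom (K.K i) (tensorMap (𝟙 F) ι) a)
    rw [hΦ] at hx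
    have heq : K.splitEquiv i (h.shortExact_tensor F) (h.tensorUnit_comp_tensorSlice F) (a, 0)
        = K.splitEquiv i (h.shortExact_tensor F) (h.tensorUnit_comp_tensorSlice F)
          (0, x.1 0) := by
      rw [K.splitEquiv_apply, K.splitEquiv_apply, hx, map_zero, map_zero, add_zero, zero_add]
    exact congrArg Prod.fst ((AddEquiv.injective _) heq)
  -- All groups `Kᵢ(F ⊗ A)` vanish, so the zero maps form a `Υ`-structure of type `(0, 0)`.
  exact ⟨{
    iso := fun i F =>
      { toFun := fun _ => 0
        invFun := fun _ => 0
        left_inv := fun _ => Subsingleton.elim _ _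
        right_inv := fun a => (hsub i F a).symm
        map_add' := fun _ _ => (add_zero 0).symm }
    natural := fun i F F' φ x => map_zero _ }⟩

end IsUnitization

open CategoryTheory ECStarAlg
theorem theorem20p4 {E : Type v} [CommCStarAlgebra E] (K : KTheory.{u, v, w} E)
    (Ω : Type u) [TopologicalSpace Ω] [T2Space Ω] [LocallyCompactSpace Ω] :
    (∀ (i : ZMod 2) (F : ECStarAlg.{u} E),
      ∃ e : ((K.K i).obj (zeroAtInfty Ω F) × (K.K i).obj F) ≃+
          (K.K i).obj (continuousFunctions (OnePoint Ω) F),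
        ∀ a b, e (a, b) = mapHom (K.K i) (inclusion Ω F) a
          + mapHom (K.K i) (constants (OnePoint Ω) F) b) ∧
    (∀ (p q : ℕ) (Φ : UpsilonIso K C₀(Ω, ℂ) p q),
      ∃ Φ' : UpsilonIso K C₀(OnePoint Ω, ℂ) (p + 1) q,
        ∀ {F₁ F₂ F₃ : ECStarAlg.{u} E} (φ₁ : F₁ ⟶ F₂) (φ₂ : F₂ ⟶ F₃) (h : ShortExact φ₁ φ₂),
          Φ.Intertwines φ₁ φ₂ h → Φ'.Intertwines φ₁ φ₂ h) ∧
    (IsUpsilonNull K C₀(Ω, ℂ) ↔ IsUpsilonOne K C₀(OnePoint Ω, ℂ)) := by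
  have hΩ := isUnitization_zeroAtInftyExtend Ω
  exact ⟨fun i F => ⟨K.splitEquiv i (shortExact_inclusion Ω F) (constants_comp_evaluation _ F),
      fun a b => K.splitEquiv_apply i _ _ a b⟩,
    fun p q Φ => ⟨Φ.unitization hΩ, fun _ _ _ hΦ => hΦ.unitization hΩ⟩,
    hΩ.isUpsilonOne, hΩ.isUpsilonNull⟩
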